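/- Let $\varphi=\frac{1+\sqrt5}{2}$. A \emph{half tile} is a closed triangle with named vertices $(a,b,c)$, of one of the following kinds, in any position and of any size: a \emph{half kite} (angle $36^\circ$ at $b$, $72^\circ$ at $a,c$), a \emph{half dart} ($108^\circ$ at $b$, $36^\circ$ at $a,c$), a \emph{half thin rhomb} ($36^\circ$ at $a$, $72^\circ$ at $b,c$), a \emph{half thick rhomb} ($108^\circ$ at $a$, $36^\circ$ at $b,c$). Write $[x,y]_\varphi = x+\varphi^{-1}(y-x)$. The Penrose substitution dissects a half tile $(a,b,c)$ into half tiles smaller by the factor $\varphi$ as follows. - Half kite, with $q=[a,b]_\varphi$, $r=[b,c]_\varphi$: the half dart $(r,q,b)$ and the half kites $(q,a,r)$, $(c,a,r)$. - Half dart, with $p=[c,a]_\varphi$: the half dart $(b,p,a)$ and the half kite $(p,c,b)$. - Half thin rhomb, with $p=[a,b]_\varphi$: the half thin rhomb $(c,p,b)$ and the half thick rhomb $(p,c,a)$. - Half thick rhomb, with $q=[b,a]_\varphi$, $r=[b,c]_\varphi$: the half thick rhombs $(r,c,a)$, $(q,r,b)$ and the half thin rhomb $(r,q,a)$. A \emph{Penrose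 tiling by half tiles} is a set $\sigma$ of half tiles that cover $\mathbb R^2$ and have pairwise disjoint interiors, such that every finite subset of $\sigma$ is contained in the set of half tiles obtained from some single half tile by applying the substitution $m$ times, for some $m\ge 0$. A \emph{Penrose tiling} $\tau$ is either the set of triangles of such a $\sigma$ (Robinson triangles), or the set of all unions of two distinct half tiles of $\sigma$ of the same kind with the same vertex $b$ and the same vertex $c$ (this is a tiling by kites and darts, or by thin and thick rhombs). For a tiling $\tau$ of the plane let $f_\tau:\mathbb R^2\to\mathbb R$ be given by $f_\tau(x)=1/|T|$ if $x$ lies in the interior of a tile $T$ of $\tau$, where $|T|$ is the area of $T$, and $f_\tau(x)=0$ if $x$ lies in the interior of no tile. Corollary 1.5. For every Penrose tiling $\tau$ there is a homeomorphism $\phi:\mathbb R^2\to\mathbb R^2$ such that $\phi$ and $\phi^{-1}$ are Lipschitz, and for almost every $x$ the map $\phi$ is differentiable at $x$ with $\det D_\phi(x)=f_\tau(x)$. -/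

import Mathlib

noncomputable section

namespace Penrose

open MeasureTheory
open scoped goldenRatio

/-- The Euclidean plane. -/
abbrev Plane : Type := EuclideanSpace ℝ (Fin 2)

/-- The function of a family `τ` of planar regions: on the interior of a tile `T` its value is
`1 / area T`, and it vanishes outside the interiors of the tiles. (If the interiors of the tiles
are pairwise disjoint, the tile that is chosen is the only one.) -/
def tilingFun (τ : Set (Set Plane)) (x : Plane) : ℝ :=
  open Classical in
  if h : ∃ T ∈ τ, x ∈ interior T then 1 / (volume h.choose).toReal else 0

/-- The four kinds of half tiles (Robinson triangles): halves of kites and darts, and halves of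
thin and thick rhombs. -/
inductive Kind : Type
  | halfKite
  | halfDart
  | halfThin
  | halfThick

/-- A half tile: a triangle with named vertices. In each kind the side `[b, c]` is the
axis along which the tile (kite, dart or rhomb) was cut into its two mirror halves. -/
@[ext]
structure HalfTile : Type where
  kind : Kind
  a : Plane
  b : Plane
  c : Plane

namespace HalfTile

/-- The closed triangle that a half tile occupies. -/
def region (t : HalfTile) : Set Plane := convexHull ℝ {t.a, t.b, t.c}

/-- The shapes of the half tiles, up to congruence and scale.
* half kite: angle 36° at `b`, angles 72° at `a` and `c`;
* half dart: angle 108° at `b`, angles 36° at `a` and `c`;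
* half of a thin rhomb: angle 36° at `a`, angles 72° at `b` and `c`;
* half of a thick rhomb: angle 108° at `a`, angles 36° at `b` and `c`. -/
def IsWellShaped : HalfTile → Prop
  | ⟨.halfKite, a, b, c⟩ => 0 < dist a c ∧ dist b a = φ * dist a c ∧ dist b c = φ * dist a c
  | ⟨.halfDart, a, b, c⟩ => 0 < dist b a ∧ dist b c = dist b a ∧ dist a c = φ * dist b a
  | ⟨.halfThin, a, b, c⟩ => 0 < dist b c ∧ dist a b = φ * dist b c ∧ dist a c = φ * dist b c
  | ⟨.halfThick, a, b, c⟩ => 0 < dist a b ∧ dist a c = dist a b ∧ dist b c = φ * dist a b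

/-- The point of the segment `[x, y]` at distance `|y - x| / φ` from `x`. -/
def cut (x y : Plane) : Plane := AffineMap.lineMap x y (φ⁻¹ : ℝ)

/-- The Penrose substitution: the dissection of a half tile into half tiles that are smaller
by the factor `φ`. -/
def children : HalfTile → List HalfTile
  | ⟨.halfKite, a, b, c⟩ =>
      [⟨.halfDart, cut b c, cut a b, b⟩, ⟨.halfKite, cut a b, a, cut b c⟩,
        ⟨.halfKite, c, a, cut b c⟩]
  | ⟨.halfDart, a, b, c⟩ =>
      [⟨.halfDart, b, cut c a, a⟩, ⟨.halfKite, cut c a, c, b⟩]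
  | ⟨.halfThin, a, b, c⟩ =>
      [⟨.halfThin, c, cut a b, b⟩, ⟨.halfThick, cut a b, c, a⟩]
  | ⟨.halfThick, a, b, c⟩ =>
      [⟨.halfThick, cut b c, c, a⟩, ⟨.halfThick, cut b a, cut b c, b⟩,
        ⟨.halfThin, cut b c, cut b a, a⟩]

/-- The half tiles that are obtained from `t` by applying the substitution `m` times. -/
def descendants (t : HalfTile) : ℕ → Set HalfTile
  | 0 => {t}
  | m + 1 => {u | ∃ s ∈ t.descendants m, u ∈ s.children}

end HalfTile

/-- A Penrose tiling by half tiles, that is, a tiling of the plane in the substitution tiling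
space of the Penrose substitution: the half tiles cover the plane, have pairwise disjoint
interiors, and each finite patch is part of the `m`-fold substitution of one half tile. -/
structure IsHalfTileTiling (σ : Set HalfTile) : Prop where
  cover : ⋃ t ∈ σ, t.region = Set.univ
  disjoint : σ.Pairwise fun t u => Disjoint (interior t.region) (interior u.region)
  patch : ∀ P : Set HalfTile, P ⊆ σ → P.Finite →
    ∃ (s : HalfTile) (m : ℕ), s.IsWellShaped ∧ P ⊆ s.descendants m

/-- The tiling by the triangles themselves. -/
def triangles (σ : Set HalfTile) : Set (Set Plane) :=
  {T | ∃ t ∈ σ, T = t.region}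

/-- The tiling by whole tiles (kites and darts, or thin and thick rhombs): each tile
is the union of two distinct half tiles of the same kind that have the axis `[b, c]` in common. -/
def wholeTiles (σ : Set HalfTile) : Set (Set Plane) :=
  {T | ∃ t ∈ σ, ∃ u ∈ σ, t ≠ u ∧ t.kind = u.kind ∧ t.b = u.b ∧ t.c = u.c ∧
    T = t.region ∪ u.region}

/-- Penrose tilings: by kites and darts, by thin and thick rhombs, or by the Robinson triangles
of either family, in any position and at any scale. -/
def IsPenroseTiling (τ : Set (Set Plane)) : Prop :=
  ∃ σ : Set HalfTile, IsHalfTileTiling σ ∧ (τ = wholeTiles σ ∨ τ = triangles σ)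

end Penrose

end

noncomputable section

namespace Penrose

open MeasureTheory
open scoped goldenRatio

/-! It suffices to find a bi-Lipschitz homeomorphism of the plane that is affine on each half tile,
preserves orientation there, and sends all half tiles to triangles of one prescribed area. Its
Jacobian on a half tile is then inversely proportional to the area of the half tile. The two halves
of a whole tile have equal area, so the tilings by whole tiles differ from those by triangles only
by a factor 2 in the prescribed area.

Every half tile is an acute or obtuse golden triangle, and a cut at the golden section of a long
side gives two golden triangles with the fractions `φ⁻¹` and `φ⁻²` of the area. Half darts and half
thin rhombs get level 1, half kites and half thick rhombs level 2. A triangle of level `n + 3` is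
cut into one of level `n + 2` and one of level `n + 1`; two levels make one substitution
(`descendants_subset_leaves`). Thus a triangle of level `n` consists of `fib n` half tiles. For
equal areas, the cut of a triangle of level `n + 3` should divide the side in the proportion `fib (n
+ 2) : fib (n + 1)`. The piecewise affine map `slide` moves the cut point there and fixes the other
two sides pointwise. The Fibonacci ratio differs from `φ⁻¹` by at most `φ⁻¹ ^ (n + 2)`, so the
Lipschitz constants of this map and its inverse exceed 1 by a geometrically small amount.

The equalizing map of a triangle is built recursively (`exists_isEqualizer`): the maps of the two
parts are glued and followed by `slide`. They agree on the cut because the action on a side depends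
only on the type and the index of the side (`edgeMap`). The Lipschitz constants multiply to a
bounded product (`lipConst_le`).

Every finite part of the tiling lies in the dissection of such a triangle. After translation and
scaling, the maps of these triangles have a limit along an ultrafilter
(`exists_homeomorph_tendsto`). The scales are bounded because `fib n` is comparable to `φ ^ n`
(`leaf_mass_bounds`), and the images exhaust the plane by `IsEqualizer.ball_subset`. Affinity and
areas pass to the limit (`IsHalfTileTiling.exists_homeomorph`). For whole tiles one also needs that
each half tile has its other half in the tiling (`IsHalfTileTiling.exists_partner`). -/

/-! ### Signed areas, triangles and barycentric coordinates -/

/-- The determinant of two plane vectors. -/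
def cross (p q : Plane) : ℝ := p 0 * q 1 - p 1 * q 0

/-- Twice the signed area of the triangle `u v w`. -/
def ar (u v w : Plane) : ℝ := cross (v - u) (w - u)

/-- The closed triangle with vertices `u`, `v`, `w`. -/
def tri (u v w : Plane) : Set Plane := convexHull ℝ {u, v, w}

theorem ar_eq (u v w : Plane) :
    ar u v w = (v 0 - u 0) * (w 1 - u 1) - (v 1 - u 1) * (w 0 - u 0) := rfl

theorem norm_sq_eq_coords (p : Plane) : ‖p‖ ^ 2 = p 0 ^ 2 + p 1 ^ 2 := by
  simp [EuclideanSpace.norm_sq_eq, Fin.sum_univ_two]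

theorem abs_cross_le (p q : Plane) : |cross p q| ≤ ‖p‖ * ‖q‖ := by
  apply abs_le_of_sq_le_sq _ (by positivity)
  rw [mul_pow, norm_sq_eq_coords, norm_sq_eq_coords, cross]
  nlinarith [sq_nonneg (p 0 * q 0 + p 1 * q 1)]

theorem ar_rotate (u v w : Plane) : ar v w u = ar u v w := by
  simp only [ar_eq]; ring

theorem ar_swap (u v w : Plane) : ar u w v = -ar u v w := by
  simp only [ar_eq]; ring

/-- The signed area in terms of the side lengths (Heron's formula). -/
theorem ar_sq (u v w : Plane) :
    4 * ar u v w ^ 2 = 4 * dist u v ^ 2 * dist u w ^ 2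
      - (dist u v ^ 2 + dist u w ^ 2 - dist v w ^ 2) ^ 2 := by
  simp only [dist_eq_norm, norm_sq_eq_coords, ar_eq, PiLp.sub_apply]
  ring

theorem mem_tri {u v w x : Plane} : x ∈ tri u v w ↔
    ∃ α β γ : ℝ, 0 ≤ α ∧ 0 ≤ β ∧ 0 ≤ γ ∧ α + β + γ = 1 ∧ x = α • u + β • v + γ • w := by
  unfold tri
  constructor
  · intro hx
    rw [convexHull_insert (by simp), convexHull_pair] at hx
    simp only [convexJoin, Set.mem_iUnion, Set.mem_singleton_iff, exists_prop,
      exists_eq_left] at hx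
    obtain ⟨y, ⟨α, β, hα, hβ, hs, rfl⟩, hx⟩ := hx
    obtain ⟨γ, δ, hγ, hδ, hs', rfl⟩ := hx
    refine ⟨γ, δ * α, δ * β, hγ, by positivity, by positivity, ?_, ?_⟩
    · rw [← hs', add_assoc, ← mul_add, hs, mul_one]
    · simp only [smul_add, smul_smul, add_assoc]
  · rintro ⟨α, β, γ, hα, hβ, hγ, hs, rfl⟩
    have hc := convex_convexHull ℝ ({u, v, w} : Set Plane)
    have hu : u ∈ convexHull ℝ ({u, v, w} : Set Plane) := subset_convexHull _ _ (by simp)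
    have hv : v ∈ convexHull ℝ ({u, v, w} : Set Plane) := subset_convexHull _ _ (by simp)
    have hw : w ∈ convexHull ℝ ({u, v, w} : Set Plane) := subset_convexHull _ _ (by simp)
    have := hc.sum_mem (t := Finset.univ) (w := ![α, β, γ]) (z := ![u, v, w])
      (by intro i _; fin_cases i <;> simpa) (by simp [Fin.sum_univ_three, hs])
      (by intro i _; fin_cases i <;> simpa)
    simpa [Fin.sum_univ_three] using this

theorem convex_tri (u v w : Plane) : Convex ℝ (tri u v w) := convex_convexHull _ _

theorem isCompact_tri (u v w : Plane) : IsCompact (tri u v w) :=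
  (Set.toFinite _).isCompact_convexHull ℝ

theorem tri_rotate (u v w : Plane) : tri v w u = tri u v w := by
  unfold tri; congr 1; ext; simp; tauto

theorem tri_swap (u v w : Plane) : tri u w v = tri u v w := by
  unfold tri; congr 1; ext; simp; tauto

theorem left_mem_tri (u v w : Plane) : u ∈ tri u v w := subset_convexHull _ _ (by simp)
theorem mid_mem_tri (u v w : Plane) : v ∈ tri u v w := subset_convexHull _ _ (by simp)
theorem right_mem_tri (u v w : Plane) : w ∈ tri u v w := subset_convexHull _ _ (by simp)

theorem ar_affine (v w x y z : Plane) {α β γ : ℝ} (h : α + β + γ = 1) :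
    ar (α • x + β • y + γ • z) v w = α * ar x v w + β * ar y v w + γ * ar z v w := by
  obtain rfl : γ = 1 - α - β := by linarith
  simp only [ar_eq, PiLp.add_apply, PiLp.smul_apply, smul_eq_mul]
  ring

theorem ar_self_left (u w : Plane) : ar u u w = 0 := by simp [ar_eq]
theorem ar_self_right (u w : Plane) : ar u w w = 0 := by simp only [ar_eq]; ring
theorem ar_self_outer (u w : Plane) : ar w u w = 0 := by simp [ar_eq]

theorem ar_add_ar_add_ar (u v w x : Plane) :
    ar x v w + ar x w u + ar x u v = ar u v w := by
  simp only [ar_eq]; ring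

/-- The barycentric coordinate of `x` at the vertex `u` of the triangle `u v w`. -/
def bary (u v w x : Plane) : ℝ := ar x v w / ar u v w

section bary

variable {u v w : Plane}

theorem bary_add (h : ar u v w ≠ 0) (x : Plane) :
    bary u v w x + bary v w u x + bary w u v x = 1 := by
  unfold bary
  rw [ar_rotate v w u, ar_rotate u v w, ← add_div, ← add_div,
    ar_add_ar_add_ar, div_self h]

theorem bary_affine (x y z : Plane) {α β γ : ℝ} (h : α + β + γ = 1) :
    bary u v w (α • x + β • y + γ • z) =
      α * bary u v w x + β * bary u v w y + γ * bary u v w z := by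
  unfold bary; rw [ar_affine _ _ _ _ _ h]; ring

theorem bary_left (h : ar u v w ≠ 0) : bary u v w u = 1 := div_self h
theorem bary_mid : bary u v w v = 0 := by simp [bary, ar_self_left]
theorem bary_right : bary u v w w = 0 := by simp [bary, ar_self_outer]

theorem eq_bary_comb (h : ar u v w ≠ 0) (x : Plane) :
    x = bary u v w x • u + bary v w u x • v + bary w u v x • w := by
  unfold bary
  rw [ar_rotate v w u, ar_rotate u v w]
  ext i
  simp only [PiLp.add_apply, PiLp.smul_apply, smul_eq_mul]
  field_simp
  fin_cases i <;> (simp only [ar_eq, Fin.zero_eta, Fin.mk_one, Fin.isValue]; ring)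

theorem mem_tri_iff (h : ar u v w ≠ 0) {x : Plane} :
    x ∈ tri u v w ↔ 0 ≤ bary u v w x ∧ 0 ≤ bary v w u x ∧ 0 ≤ bary w u v x := by
  constructor
  · rw [mem_tri]
    rintro ⟨α, β, γ, hα, hβ, hγ, hs, rfl⟩
    have h1 : ar v w u ≠ 0 := by rwa [ar_rotate]
    have h2 : ar w u v ≠ 0 := by rwa [ar_rotate, ar_rotate]
    simp only [bary_affine _ _ _ hs, bary_left h, bary_left h1, bary_left h2, bary_mid, bary_right]
    refine ⟨by linarith, by linarith, by linarith⟩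
  · rintro ⟨h1, h2, h3⟩
    exact mem_tri.2 ⟨_, _, _, h1, h2, h3, bary_add h x, eq_bary_comb h x⟩

theorem bary_sub_bary (x y : Plane) :
    bary u v w x - bary u v w y = cross (w - v) (x - y) / ar u v w := by
  unfold bary
  rw [← sub_div]
  congr 1
  simp only [ar_eq, cross, PiLp.sub_apply]
  ring

theorem abs_bary_sub_le (x y : Plane) :
    |bary u v w x - bary u v w y| ≤ dist v w / |ar u v w| * dist x y := by
  rw [bary_sub_bary, abs_div, div_mul_eq_mul_div, dist_eq_norm x y, dist_comm v w, dist_eq_norm]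
  gcongr
  exact abs_cross_le _ _

theorem continuous_bary (u v w : Plane) : Continuous (bary u v w) := by
  unfold bary
  simp only [ar_eq]
  fun_prop

/-- The barycentric coordinate as an affine function along a direction. -/
theorem bary_add_smul (x : Plane) (c : ℝ) (p : Plane) :
    bary u v w (x + c • p) = bary u v w x + c * (cross (w - v) p / ar u v w) := by
  have := bary_sub_bary (u := u) (v := v) (w := w) (x + c • p) x
  rw [add_sub_cancel_left] at this
  have h2 : cross (w - v) (c • p) = c * cross (w - v) p := by
    simp only [cross, PiLp.smul_apply, smul_eq_mul]; ring
  rw [h2] at this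
  linear_combination this

theorem bary_add_smul_sub (h : ar u v w ≠ 0) (x : Plane) (c : ℝ) :
    bary u v w (x + c • (v - u)) = bary u v w x - c := by
  rw [bary_add_smul]
  have : cross (w - v) (v - u) = - ar u v w := by
    simp only [ar_eq, cross, PiLp.sub_apply]; ring
  rw [this]
  field_simp
  ring

/-- The step `v - u` lowers the coordinate at unit rate, so a point where it is not positive has
points of negative coordinate arbitrarily near. -/
theorem bary_pos_of_mem_interior (h : ar u v w ≠ 0) {s : Set Plane}
    (hs : ∀ x ∈ s, 0 ≤ bary u v w x) {x : Plane} (hx : x ∈ interior s) : 0 < bary u v w x := by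
  by_contra hneg
  have hc : Filter.Tendsto (fun c : ℝ => x + c • (v - u)) (nhdsWithin 0 (Set.Ioi 0)) (nhds x) := by
    have : Continuous (fun c : ℝ => x + c • (v - u)) := by fun_prop
    have := this.tendsto 0
    simp only [zero_smul, add_zero] at this
    exact this.mono_left nhdsWithin_le_nhds
  obtain ⟨c, hc1, hc2⟩ := ((hc.eventually (mem_interior_iff_mem_nhds.1 hx)).and
    self_mem_nhdsWithin).exists
  have := hs _ hc1
  rw [bary_add_smul_sub h x c] at this
  have : (0:ℝ) < c := hc2
  linarith

theorem interior_tri_nonempty (h : ar u v w ≠ 0) : (interior (tri u v w)).Nonempty := by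
  have ho : IsOpen {x | 0 < bary u v w x ∧ 0 < bary v w u x ∧ 0 < bary w u v x} :=
    ((isOpen_lt continuous_const (continuous_bary _ _ _)).inter
      ((isOpen_lt continuous_const (continuous_bary _ _ _)).inter
        (isOpen_lt continuous_const (continuous_bary _ _ _))))
  refine ⟨(1/3:ℝ) • u + (1/3:ℝ) • v + (1/3:ℝ) • w, interior_maximal ?_ ho ?_⟩
  · intro x hx
    exact (mem_tri_iff h).2 ⟨hx.1.le, hx.2.1.le, hx.2.2.le⟩
  · have hs : (1/3:ℝ) + 1/3 + 1/3 = 1 := by norm_num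
    have h1 : ar v w u ≠ 0 := by rwa [ar_rotate]
    have h2 : ar w u v ≠ 0 := by rwa [ar_rotate, ar_rotate]
    simp only [Set.mem_ofPred_eq, bary_affine _ _ _ hs, bary_left h, bary_left h1, bary_left h2,
      bary_mid, bary_right]
    norm_num

end bary

/-! ### Cutting a triangle along a segment from a vertex -/

section Cut

variable {u v w : Plane} {κ κ' : ℝ}

theorem lineMap_coord (x y : Plane) (c : ℝ) (i : Fin 2) :
    (AffineMap.lineMap x y c : Plane) i = x i + c * (y i - x i) := by
  simp [AffineMap.lineMap_apply]; ring

theorem ar_lineMap_left (u v w : Plane) (κ : ℝ) :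
    ar u (AffineMap.lineMap u v κ) w = κ * ar u v w := by
  simp only [ar_eq, lineMap_coord]; ring

theorem ar_lineMap_right (u v w : Plane) (κ : ℝ) :
    ar (AffineMap.lineMap u v κ) v w = (1 - κ) * ar u v w := by
  simp only [ar_eq, lineMap_coord]; ring

/-- The line through `w` and the cut point is the one on which the coordinates at `u` and `v` are in
the proportion `(1 - κ) : κ`. -/
theorem mem_tri_lineMap_left (h : ar u v w ≠ 0) (h0 : 0 < κ) (h1 : κ < 1) {x : Plane} :
    x ∈ tri u (AffineMap.lineMap u v κ) w ↔
      x ∈ tri u v w ∧ (1 - κ) * bary v w u x ≤ κ * bary u v w x := by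
  have hX : ar u (AffineMap.lineMap u v κ) w ≠ 0 := by
    rw [ar_lineMap_left]; exact mul_ne_zero h0.ne' h
  have e1 : bary u (AffineMap.lineMap u v κ) w x
      = (κ * bary u v w x - (1 - κ) * bary v w u x) / κ := by
    unfold bary
    rw [ar_lineMap_left, ar_rotate u v w]
    field_simp
    simp only [ar_eq, lineMap_coord]; ring
  have e2 : bary (AffineMap.lineMap u v κ) w u x = bary v w u x / κ := by
    unfold bary
    rw [ar_rotate u (AffineMap.lineMap u v κ) w, ar_lineMap_left, ar_rotate u v w]
    field_simp
  have e3 : bary w u (AffineMap.lineMap u v κ) x = bary w u v x := by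
    unfold bary
    rw [ar_rotate _ w u, ar_rotate u _ w, ar_lineMap_left, ar_rotate v w u, ar_rotate u v w]
    field_simp
    simp only [ar_eq, lineMap_coord]; ring
  have hd : ∀ a : ℝ, 0 ≤ a / κ ↔ 0 ≤ a := fun a => by rw [le_div_iff₀ h0, zero_mul]
  rw [mem_tri_iff hX, mem_tri_iff h, e1, e2, e3, hd, hd]
  constructor
  · rintro ⟨a, b, c⟩
    refine ⟨⟨?_, b, c⟩, by linarith⟩
    have : 0 ≤ (1 - κ) * bary v w u x := mul_nonneg (by linarith) b
    exact nonneg_of_mul_nonneg_right (by linarith) h0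
  · rintro ⟨⟨a, b, c⟩, d⟩
    exact ⟨by linarith, b, c⟩

theorem mem_tri_lineMap_right (h : ar u v w ≠ 0) (h0 : 0 < κ) (h1 : κ < 1) {x : Plane} :
    x ∈ tri (AffineMap.lineMap u v κ) v w ↔
      x ∈ tri u v w ∧ κ * bary u v w x ≤ (1 - κ) * bary v w u x := by
  have h' : ar v u w ≠ 0 := by rw [← ar_rotate, ar_swap]; exact neg_ne_zero.2 h
  have e := mem_tri_lineMap_left h' (κ := 1 - κ) (by linarith) (by linarith) (x := x)
  have t1 : tri v u w = tri u v w := by rw [← tri_rotate, tri_swap]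
  have t2 : tri v (AffineMap.lineMap u v κ) w = tri (AffineMap.lineMap u v κ) v w := by
    rw [← tri_rotate, tri_swap]
  have b1 : bary v u w x = bary v w u x := by
    unfold bary; rw [ar_swap, ar_swap v w u, neg_div_neg_eq]
  have b2 : bary u w v x = bary u v w x := by
    unfold bary; rw [ar_swap, ar_swap u v w, neg_div_neg_eq]
  rw [AffineMap.lineMap_apply_one_sub, t1, t2, b1, b2] at e
  rw [e]
  simp

theorem tri_eq_union (h : ar u v w ≠ 0) (h0 : 0 < κ) (h1 : κ < 1) :
    tri u v w = tri u (AffineMap.lineMap u v κ) w ∪ tri (AffineMap.lineMap u v κ) v w := by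
  ext x
  rw [Set.mem_union, mem_tri_lineMap_left h h0 h1, mem_tri_lineMap_right h h0 h1]
  have := le_total ((1 - κ) * bary v w u x) (κ * bary u v w x)
  tauto

/-- In both parts the two inequalities become an equality, which together with the sum 1 leaves only
the coordinate at `w` free. -/
theorem exists_lineMap_of_mem_inter (h : ar u v w ≠ 0) (h0 : 0 < κ) (h1 : κ < 1) {x : Plane}
    (hx1 : x ∈ tri u (AffineMap.lineMap u v κ) w) (hx2 : x ∈ tri (AffineMap.lineMap u v κ) v w) :
    ∃ s ∈ Set.Icc (0 : ℝ) 1, x = AffineMap.lineMap w (AffineMap.lineMap u v κ) s := by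
  rw [mem_tri_lineMap_left h h0 h1] at hx1
  rw [mem_tri_lineMap_right h h0 h1] at hx2
  obtain ⟨hx, hle⟩ := hx1
  have hx' := (mem_tri_iff h).1 hx
  have hsum := bary_add h x
  refine ⟨1 - bary w u v x, ⟨by linarith, by linarith⟩, ?_⟩
  have heq := le_antisymm hx2.2 hle
  have e1 : bary u v w x = (1 - κ) * (1 - bary w u v x) := by
    linear_combination (1 - κ) * hsum + heq
  have e2 : bary v w u x = κ * (1 - bary w u v x) := by
    linear_combination κ * hsum - heq
  ext i
  conv_lhs => rw [eq_bary_comb h x]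
  simp only [lineMap_coord, PiLp.add_apply, PiLp.smul_apply, smul_eq_mul]
  rw [e1, e2]; ring

/-- A segment from one part of a cut triangle to the other crosses the cut. -/
theorem exists_cross_point (h : ar u v w ≠ 0) (h0 : 0 < κ) (h1 : κ < 1) {x y : Plane}
    (hx : x ∈ tri u (AffineMap.lineMap u v κ) w) (hy : y ∈ tri (AffineMap.lineMap u v κ) v w) :
    ∃ z ∈ tri u (AffineMap.lineMap u v κ) w ∩ tri (AffineMap.lineMap u v κ) v w,
      dist x z + dist z y = dist x y := by
  have hx' := (mem_tri_lineMap_left h h0 h1).1 hx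
  have hy' := (mem_tri_lineMap_right h h0 h1).1 hy
  let g : ℝ → ℝ := fun θ => κ * bary u v w (AffineMap.lineMap x y θ)
    - (1 - κ) * bary v w u (AffineMap.lineMap x y θ)
  have hg : Continuous g := by
    have c1 := continuous_bary u v w
    have c2 := continuous_bary v w u
    have c3 : Continuous (AffineMap.lineMap x y : ℝ → Plane) := AffineMap.lineMap_continuous
    fun_prop
  have hmem : (0:ℝ) ∈ Set.Icc (g 1) (g 0) := by
    constructor
    · simp only [g, AffineMap.lineMap_apply_one]; linarith
    · simp only [g, AffineMap.lineMap_apply_zero]; linarith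
  obtain ⟨θ, hθ, hz⟩ := intermediate_value_Icc' zero_le_one hg.continuousOn hmem
  have hT : (AffineMap.lineMap x y θ : Plane) ∈ tri u v w :=
    (convex_tri u v w).lineMap_mem hx'.1 hy'.1 hθ
  refine ⟨AffineMap.lineMap x y θ, ⟨(mem_tri_lineMap_left h h0 h1).2 ⟨hT, ?_⟩,
    (mem_tri_lineMap_right h h0 h1).2 ⟨hT, ?_⟩⟩, ?_⟩
  · simp only [g] at hz; linarith
  · simp only [g] at hz; linarith
  · rw [dist_left_lineMap, dist_lineMap_right, Real.norm_of_nonneg hθ.1,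
      Real.norm_of_nonneg (by linarith [hθ.2])]; ring

end Cut

/-! ### Bi-Lipschitz self-maps and their gluing -/

/-- Mutually inverse self-maps `F`, `G` of `T`, both Lipschitz with constant `L`. -/
structure SelfMap (T : Set Plane) (L : ℝ) (F G : Plane → Plane) : Prop where
  mapsTo : Set.MapsTo F T T
  mapsTo_inv : Set.MapsTo G T T
  left_inv : ∀ x ∈ T, G (F x) = x
  right_inv : ∀ x ∈ T, F (G x) = x
  lip : ∀ x ∈ T, ∀ y ∈ T, dist (F x) (F y) ≤ L * dist x y
  lip_inv : ∀ x ∈ T, ∀ y ∈ T, dist (G x) (G y) ≤ L * dist x y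

theorem SelfMap.id {T : Set Plane} : SelfMap T 1 id id :=
  ⟨fun _ h => h, fun _ h => h, fun _ _ => rfl, fun _ _ => rfl, by simp, by simp⟩

theorem SelfMap.mono {T : Set Plane} {L L' : ℝ} {F G : Plane → Plane} (h : SelfMap T L F G)
    (hL : L ≤ L') : SelfMap T L' F G :=
  ⟨h.1, h.2, h.3, h.4,
    fun x hx y hy => (h.5 x hx y hy).trans (by gcongr),
    fun x hx y hy => (h.6 x hx y hy).trans (by gcongr)⟩

theorem SelfMap.comp {T : Set Plane} {L L' : ℝ} {F G F' G' : Plane → Plane}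
    (h' : SelfMap T L' F' G') (h : SelfMap T L F G) (hL : 0 ≤ L) (hL' : 0 ≤ L') :
    SelfMap T (L' * L) (F' ∘ F) (G ∘ G') where
  mapsTo := h'.mapsTo.comp h.mapsTo
  mapsTo_inv := h.mapsTo_inv.comp h'.mapsTo_inv
  left_inv x hx := by
    simp only [Function.comp_apply]
    rw [h'.left_inv _ (h.mapsTo hx), h.left_inv x hx]
  right_inv x hx := by
    simp only [Function.comp_apply]
    rw [h.right_inv _ (h'.mapsTo_inv hx), h'.right_inv x hx]
  lip x hx y hy := (h'.lip _ (h.mapsTo hx) _ (h.mapsTo hy)).trans <| by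
    rw [mul_assoc]; gcongr; exact h.lip x hx y hy
  lip_inv x hx y hy := (h.lip_inv _ (h'.mapsTo_inv hx) _ (h'.mapsTo_inv hy)).trans <| by
    rw [mul_comm L', mul_assoc]; gcongr; exact h'.lip_inv x hx y hy

open Classical in
/-- Gluing of self-maps of two sets that agree on the intersection. -/
theorem SelfMap.glue {T₁ T₂ : Set Plane} {L : ℝ} {F₁ G₁ F₂ G₂ : Plane → Plane}
    (h₁ : SelfMap T₁ L F₁ G₁) (h₂ : SelfMap T₂ L F₂ G₂)
    (hF : ∀ x ∈ T₁ ∩ T₂, F₁ x = F₂ x) (hG : ∀ x ∈ T₁ ∩ T₂, G₁ x = G₂ x)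
    (hcross : ∀ x ∈ T₁, ∀ y ∈ T₂, ∃ z ∈ T₁ ∩ T₂, dist x z + dist z y = dist x y) :
    ∃ F G, SelfMap (T₁ ∪ T₂) L F G ∧ Set.EqOn F F₁ T₁ ∧ Set.EqOn F F₂ T₂ := by
  -- Used for the maps and for their inverses. The mixed Lipschitz bound goes through the point `z`
  -- of the intersection on the way from `x` to `y`, so the constant does not grow.
  have key : ∀ F₁ F₂ : Plane → Plane, (∀ x ∈ T₁ ∩ T₂, F₁ x = F₂ x) →
      (∀ x ∈ T₁, ∀ y ∈ T₁, dist (F₁ x) (F₁ y) ≤ L * dist x y) →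
      (∀ x ∈ T₂, ∀ y ∈ T₂, dist (F₂ x) (F₂ y) ≤ L * dist x y) →
      ∃ F : Plane → Plane, Set.EqOn F F₁ T₁ ∧ Set.EqOn F F₂ T₂ ∧
        ∀ x ∈ T₁ ∪ T₂, ∀ y ∈ T₁ ∪ T₂, dist (F x) (F y) ≤ L * dist x y := by
    intro F₁ F₂ hF l₁ l₂
    have e₁ : Set.EqOn (fun x => if x ∈ T₁ then F₁ x else F₂ x) F₁ T₁ := fun x hx => by simp [hx]
    have e₂ : Set.EqOn (fun x => if x ∈ T₁ then F₁ x else F₂ x) F₂ T₂ := fun x hx => by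
      by_cases h : x ∈ T₁
      · simp only [h, if_true]; exact hF x ⟨h, hx⟩
      · simp [h]
    have mixed : ∀ x ∈ T₁, ∀ y ∈ T₂, dist (F₁ x) (F₂ y) ≤ L * dist x y := by
      intro x hx y hy
      obtain ⟨z, hz, hd⟩ := hcross x hx y hy
      calc dist (F₁ x) (F₂ y) ≤ dist (F₁ x) (F₁ z) + dist (F₁ z) (F₂ y) := dist_triangle _ _ _
        _ ≤ L * dist x z + L * dist z y := by
            refine add_le_add (l₁ x hx z hz.1) ?_
            rw [hF z hz]
            exact l₂ z hz.2 y hy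
        _ = L * dist x y := by rw [← hd]; ring
    generalize (fun x => if x ∈ T₁ then F₁ x else F₂ x) = F at e₁ e₂
    refine ⟨F, e₁, e₂, ?_⟩
    rintro x (hx | hx) y (hy | hy)
    · rw [e₁ hx, e₁ hy]; exact l₁ x hx y hy
    · rw [e₁ hx, e₂ hy]; exact mixed x hx y hy
    · rw [e₂ hx, e₁ hy, dist_comm, dist_comm x]; exact mixed y hy x hx
    · rw [e₂ hx, e₂ hy]; exact l₂ x hx y hy
  obtain ⟨F, f₁, f₂, lF⟩ := key F₁ F₂ hF h₁.lip h₂.lip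
  obtain ⟨G, g₁, g₂, lG⟩ := key G₁ G₂ hG h₁.lip_inv h₂.lip_inv
  refine ⟨F, G, ⟨?_, ?_, ?_, ?_, lF, lG⟩, f₁, f₂⟩
  · rintro x (hx | hx)
    · rw [f₁ hx]; exact Or.inl (h₁.mapsTo hx)
    · rw [f₂ hx]; exact Or.inr (h₂.mapsTo hx)
  · rintro x (hx | hx)
    · rw [g₁ hx]; exact Or.inl (h₁.mapsTo_inv hx)
    · rw [g₂ hx]; exact Or.inr (h₂.mapsTo_inv hx)
  · rintro x (hx | hx)
    · rw [f₁ hx, g₁ (h₁.mapsTo hx), h₁.left_inv x hx]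
    · rw [f₂ hx, g₂ (h₂.mapsTo hx), h₂.left_inv x hx]
  · rintro x (hx | hx)
    · rw [g₁ hx, f₁ (h₁.mapsTo_inv hx), h₁.right_inv x hx]
    · rw [g₂ hx, f₂ (h₂.mapsTo_inv hx), h₂.right_inv x hx]

/-! ### The piecewise affine map that moves the cut point -/

/-- The piecewise affine self-map of the triangle `u v w` that fixes the vertices and takes the
point that cuts `[u, v]` in the ratio `κ` to the one that cuts it in the ratio `κ'`. -/
def slide (κ κ' : ℝ) (u v w x : Plane) : Plane :=
  x + ((κ' - κ) * min (bary v w u x / κ) (bary u v w x / (1 - κ))) • (v - u)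

section Slide

variable {u v w : Plane} {κ κ' : ℝ}

theorem bary_slide_left (h : ar u v w ≠ 0) (x : Plane) (m : ℝ) :
    bary u v w (x + m • (v - u)) = bary u v w x - m := bary_add_smul_sub h x m

theorem bary_slide_mid (h : ar u v w ≠ 0) (x : Plane) (m : ℝ) :
    bary v w u (x + m • (v - u)) = bary v w u x + m := by
  rw [bary_add_smul]
  have : cross (u - w) (v - u) = ar v w u := by
    simp only [ar_eq, cross, PiLp.sub_apply]; ring
  rw [this, div_self (by rwa [ar_rotate]), mul_one]

theorem bary_slide_right (x : Plane) (m : ℝ) :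
    bary w u v (x + m • (v - u)) = bary w u v x := by
  rw [bary_add_smul]
  have : cross (v - u) (v - u) = 0 := by simp only [cross]; ring
  rw [this]; simp

/-- Here `a`, `b` are the coordinates at `u`, `v`, and `m` is the displacement. If `b / κ = c` is
the minimum, then `b = c * κ` goes to `c * κ'`; the minimum for `κ'` is again `c` and is attained on
the same branch, so exchanging `κ` and `κ'` undoes the displacement. The other branch is symmetric.
-/
theorem slide_aux {a b : ℝ} (h0 : 0 < κ) (h1 : κ < 1) (h0' : 0 < κ') (h1' : κ' < 1)
    (ha : 0 ≤ a) (hb : 0 ≤ b) {m : ℝ} (hm : m = (κ' - κ) * min (b / κ) (a / (1 - κ))) :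
    0 ≤ a - m ∧ 0 ≤ b + m ∧ (κ - κ') * min ((b + m) / κ') ((a - m) / (1 - κ')) = -m := by
  have k1 : 0 < 1 - κ := by linarith
  have k1' : 0 < 1 - κ' := by linarith
  rcases le_total (b / κ) (a / (1 - κ)) with hle | hle
  · rw [min_eq_left hle] at hm
    obtain ⟨c, rfl⟩ : ∃ c, b = c * κ := ⟨b / κ, by field_simp⟩
    rw [mul_div_cancel_right₀ _ h0.ne'] at hm hle
    rw [le_div_iff₀ k1] at hle
    have hc : 0 ≤ c := nonneg_of_mul_nonneg_left hb h0
    have e : c * κ + m = c * κ' := by rw [hm]; ring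
    have e2 : c * (1 - κ') ≤ a - m := by rw [hm]; linarith
    refine ⟨le_trans (by positivity) e2, by rw [e]; positivity, ?_⟩
    rw [e, mul_div_cancel_right₀ _ h0'.ne', min_eq_left (by rwa [le_div_iff₀ k1']), hm]; ring
  · rw [min_eq_right hle] at hm
    obtain ⟨c, rfl⟩ : ∃ c, a = c * (1 - κ) := ⟨a / (1 - κ), by field_simp⟩
    rw [mul_div_cancel_right₀ _ k1.ne'] at hm hle
    rw [le_div_iff₀ h0] at hle
    have hc : 0 ≤ c := nonneg_of_mul_nonneg_left ha k1
    have e : c * (1 - κ) - m = c * (1 - κ') := by rw [hm]; ring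
    have e2 : c * κ' ≤ b + m := by rw [hm]; linarith
    refine ⟨by rw [e]; positivity, le_trans (by positivity) e2, ?_⟩
    rw [e, mul_div_cancel_right₀ _ k1'.ne', min_eq_right (by rwa [le_div_iff₀ h0']), hm]; ring

theorem slide_mem_and_inv (h : ar u v w ≠ 0) (h0 : 0 < κ) (h1 : κ < 1) (h0' : 0 < κ')
    (h1' : κ' < 1) {x : Plane} (hx : x ∈ tri u v w) :
    slide κ κ' u v w x ∈ tri u v w ∧ slide κ' κ u v w (slide κ κ' u v w x) = x := by
  obtain ⟨ha, hb, hc⟩ := (mem_tri_iff h).1 hx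
  obtain ⟨e1, e2, e3⟩ := slide_aux h0 h1 h0' h1' ha hb rfl
  constructor
  · rw [mem_tri_iff h]
    simp only [slide, bary_slide_left h, bary_slide_mid h, bary_slide_right]
    exact ⟨e1, e2, hc⟩
  · rw [slide]
    conv_lhs => enter [2, 1]; simp only [slide, bary_slide_left h, bary_slide_mid h]; rw [e3]
    rw [slide, neg_smul, add_neg_cancel_right]

/-- A barycentric coordinate has slope at most the opposite side divided by `|ar u v w|`. Multiplied
by the length of `v - u`, this is at most `C`; division by `κ` or `1 - κ` costs a factor 3, and a
minimum is no steeper than the steeper of its terms. -/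
theorem slide_lip {C : ℝ} (h : ar u v w ≠ 0) (h0 : 1 / 3 ≤ κ) (h1 : κ ≤ 2 / 3)
    (hC : dist u v * dist u w ≤ C * |ar u v w|) (hC' : dist u v * dist v w ≤ C * |ar u v w|)
    (x y : Plane) :
    dist (slide κ κ' u v w x) (slide κ κ' u v w y) ≤ (1 + 3 * C * |κ' - κ|) * dist x y := by
  have har : 0 < |ar u v w| := abs_pos.2 h
  have m1 : |bary v w u x / κ - bary v w u y / κ| * dist u v ≤ 3 * C * dist x y := by
    rw [← sub_div, abs_div, abs_of_nonneg (by linarith : (0:ℝ) ≤ κ)]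
    have := abs_bary_sub_le (u := v) (v := w) (w := u) x y
    rw [ar_rotate, dist_comm w u] at this
    calc _ ≤ (dist u w / |ar u v w| * dist x y) / (1/3) * dist u v := by gcongr
      _ = 3 * (dist u v * dist u w / |ar u v w|) * dist x y := by ring
      _ ≤ 3 * C * dist x y := by gcongr; rwa [div_le_iff₀ har]
  have m2 : |bary u v w x / (1 - κ) - bary u v w y / (1 - κ)| * dist u v ≤ 3 * C * dist x y := by
    rw [← sub_div, abs_div, abs_of_nonneg (by linarith : (0:ℝ) ≤ 1 - κ)]
    have := abs_bary_sub_le (u := u) (v := v) (w := w) x y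
    calc _ ≤ (dist v w / |ar u v w| * dist x y) / (1/3) * dist u v := by
            gcongr; linarith
      _ = 3 * (dist u v * dist v w / |ar u v w|) * dist x y := by ring
      _ ≤ 3 * C * dist x y := by gcongr; rwa [div_le_iff₀ har]
  have m3 : |min (bary v w u x / κ) (bary u v w x / (1 - κ))
      - min (bary v w u y / κ) (bary u v w y / (1 - κ))| * dist u v ≤ 3 * C * dist x y := by
    refine le_trans (mul_le_mul_of_nonneg_right (abs_min_sub_min_le_max _ _ _ _) dist_nonneg) ?_
    rcases max_choice |bary v w u x / κ - bary v w u y / κ|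
      |bary u v w x / (1 - κ) - bary u v w y / (1 - κ)| with e | e <;> rw [e] <;> assumption
  calc dist (slide κ κ' u v w x) (slide κ κ' u v w y)
      ≤ dist x y + dist (((κ' - κ) * min (bary v w u x / κ) (bary u v w x / (1 - κ))) • (v - u))
          (((κ' - κ) * min (bary v w u y / κ) (bary u v w y / (1 - κ))) • (v - u)) :=
        dist_add_add_le _ _ _ _
    _ = dist x y + |κ' - κ| * (|min (bary v w u x / κ) (bary u v w x / (1 - κ))
      - min (bary v w u y / κ) (bary u v w y / (1 - κ))| * dist u v) := by
        rw [dist_eq_norm (_ • _), ← sub_smul, ← mul_sub, norm_smul, Real.norm_eq_abs, abs_mul,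
          dist_comm u v, dist_eq_norm v u]; ring
    _ ≤ dist x y + |κ' - κ| * (3 * C * dist x y) := by gcongr
    _ = _ := by ring

theorem selfMap_slide {C : ℝ} (h : ar u v w ≠ 0) (h0 : 1 / 3 ≤ κ) (h1 : κ ≤ 2 / 3)
    (h0' : 1 / 3 ≤ κ') (h1' : κ' ≤ 2 / 3)
    (hC : dist u v * dist u w ≤ C * |ar u v w|) (hC' : dist u v * dist v w ≤ C * |ar u v w|) :
    SelfMap (tri u v w) (1 + 3 * C * |κ' - κ|) (slide κ κ' u v w) (slide κ' κ u v w) where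
  mapsTo x hx := (slide_mem_and_inv h (by linarith) (by linarith) (by linarith) (by linarith) hx).1
  mapsTo_inv x hx :=
    (slide_mem_and_inv h (by linarith) (by linarith) (by linarith) (by linarith) hx).1
  left_inv x hx :=
    (slide_mem_and_inv h (by linarith) (by linarith) (by linarith) (by linarith) hx).2
  right_inv x hx :=
    (slide_mem_and_inv h (by linarith) (by linarith) (by linarith) (by linarith) hx).2
  lip x _ y _ := slide_lip h h0 h1 hC hC' x y
  lip_inv x _ y _ := by rw [abs_sub_comm]; exact slide_lip h h0' h1' hC hC' x y

theorem slide_of_mem_left (h : ar u v w ≠ 0) (h0 : 0 < κ) (h1 : κ < 1) {x : Plane}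
    (hx : x ∈ tri u (AffineMap.lineMap u v κ) w) :
    slide κ κ' u v w x = x + ((κ' - κ) / κ * bary v w u x) • (v - u) := by
  have := ((mem_tri_lineMap_left h h0 h1).1 hx).2
  rw [slide, min_eq_left]
  · congr 2; ring
  · rw [div_le_div_iff₀ h0 (by linarith)]; linarith

theorem slide_of_mem_right (h : ar u v w ≠ 0) (h0 : 0 < κ) (h1 : κ < 1) {x : Plane}
    (hx : x ∈ tri (AffineMap.lineMap u v κ) v w) :
    slide κ κ' u v w x = x + ((κ' - κ) / (1 - κ) * bary u v w x) • (v - u) := by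
  have := ((mem_tri_lineMap_right h h0 h1).1 hx).2
  rw [slide, min_eq_right]
  · congr 2; ring
  · rw [div_le_div_iff₀ (by linarith) h0]; linarith

/-- The linear part is a rank one perturbation of the identity. Its determinant is `1 + c` because
the coordinate at `v` grows by 1 along `v - u`; the coordinate at `u` falls by 1, whence `1 - c` in
the companion statement. -/
theorem ar_shear_left (h : ar u v w ≠ 0) (c : ℝ) (x y z : Plane) :
    ar (x + (c * bary v w u x) • (v - u)) (y + (c * bary v w u y) • (v - u))
      (z + (c * bary v w u z) • (v - u)) = (1 + c) * ar x y z := by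
  unfold bary
  rw [ar_rotate u v w]
  simp only [ar_eq, PiLp.add_apply, PiLp.smul_apply, PiLp.sub_apply, smul_eq_mul] at h ⊢
  field_simp
  ring

theorem ar_shear_right (h : ar u v w ≠ 0) (c : ℝ) (x y z : Plane) :
    ar (x + (c * bary u v w x) • (v - u)) (y + (c * bary u v w y) • (v - u))
      (z + (c * bary u v w z) • (v - u)) = (1 - c) * ar x y z := by
  unfold bary
  simp only [ar_eq, PiLp.add_apply, PiLp.smul_apply, PiLp.sub_apply, smul_eq_mul] at h ⊢
  field_simp
  ring

theorem shear_affine {f : Plane → ℝ} (p : Plane) (c : ℝ) (x y z : Plane) {α β γ : ℝ}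
    (hf : f (α • x + β • y + γ • z) = α * f x + β * f y + γ * f z) :
    (α • x + β • y + γ • z) + (c * f (α • x + β • y + γ • z)) • p =
      α • (x + (c * f x) • p) + β • (y + (c * f y) • p) + γ • (z + (c * f z) • p) := by
  rw [hf]; module

/-- `slide` is affine on the two parts, with determinants `κ' / κ` and `(1 - κ') / (1 - κ)`. -/
theorem slide_affine_left (h : ar u v w ≠ 0) (h0 : 0 < κ) (h1 : κ < 1) {x y z : Plane}
    (hx : x ∈ tri u (AffineMap.lineMap u v κ) w) (hy : y ∈ tri u (AffineMap.lineMap u v κ) w)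
    (hz : z ∈ tri u (AffineMap.lineMap u v κ) w) :
    (∀ α β γ : ℝ, 0 ≤ α → 0 ≤ β → 0 ≤ γ → α + β + γ = 1 →
      slide κ κ' u v w (α • x + β • y + γ • z) =
        α • slide κ κ' u v w x + β • slide κ κ' u v w y + γ • slide κ κ' u v w z) ∧
    ar (slide κ κ' u v w x) (slide κ κ' u v w y) (slide κ κ' u v w z) = κ' / κ * ar x y z := by
  constructor
  · intro α β γ hα hβ hγ hs
    have hm : α • x + β • y + γ • z ∈ tri u (AffineMap.lineMap u v κ) w :=
      convexHull_min (by rintro _ (rfl | rfl | rfl) <;> assumption) (convex_tri _ _ _)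
        (mem_tri.2 ⟨α, β, γ, hα, hβ, hγ, hs, rfl⟩)
    rw [slide_of_mem_left h h0 h1 hm, slide_of_mem_left h h0 h1 hx, slide_of_mem_left h h0 h1 hy,
      slide_of_mem_left h h0 h1 hz, shear_affine _ _ _ _ _ (bary_affine x y z hs)]
  · rw [slide_of_mem_left h h0 h1 hx, slide_of_mem_left h h0 h1 hy,
      slide_of_mem_left h h0 h1 hz, ar_shear_left h]
    congr 1
    field_simp; ring

theorem slide_affine_right (h : ar u v w ≠ 0) (h0 : 0 < κ) (h1 : κ < 1) {x y z : Plane}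
    (hx : x ∈ tri (AffineMap.lineMap u v κ) v w) (hy : y ∈ tri (AffineMap.lineMap u v κ) v w)
    (hz : z ∈ tri (AffineMap.lineMap u v κ) v w) :
    (∀ α β γ : ℝ, 0 ≤ α → 0 ≤ β → 0 ≤ γ → α + β + γ = 1 →
      slide κ κ' u v w (α • x + β • y + γ • z) =
        α • slide κ κ' u v w x + β • slide κ κ' u v w y + γ • slide κ κ' u v w z) ∧
    ar (slide κ κ' u v w x) (slide κ κ' u v w y) (slide κ κ' u v w z)
      = (1 - κ') / (1 - κ) * ar x y z := by
  have k1 : 0 < 1 - κ := by linarith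
  constructor
  · intro α β γ hα hβ hγ hs
    have hm : α • x + β • y + γ • z ∈ tri (AffineMap.lineMap u v κ) v w :=
      convexHull_min (by rintro _ (rfl | rfl | rfl) <;> assumption) (convex_tri _ _ _)
        (mem_tri.2 ⟨α, β, γ, hα, hβ, hγ, hs, rfl⟩)
    rw [slide_of_mem_right h h0 h1 hm, slide_of_mem_right h h0 h1 hx,
      slide_of_mem_right h h0 h1 hy, slide_of_mem_right h h0 h1 hz,
      shear_affine _ _ _ _ _ (bary_affine x y z hs)]
  · rw [slide_of_mem_right h h0 h1 hx, slide_of_mem_right h h0 h1 hy,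
      slide_of_mem_right h h0 h1 hz, ar_shear_right h]
    congr 1
    field_simp; ring

end Slide

/-! ### Reparametrizations of the sides -/

/-- A reparametrization of the unit interval. -/
structure Reparam (e : ℝ → ℝ) : Prop where
  zero : e 0 = 0
  one : e 1 = 1
  mapsTo : Set.MapsTo e (Set.Icc 0 1) (Set.Icc 0 1)
  surjOn : Set.SurjOn e (Set.Icc 0 1) (Set.Icc 0 1)

/-- The reparametrization seen from the other end of the interval. -/
def rev (e : ℝ → ℝ) (s : ℝ) : ℝ := 1 - e (1 - s)

/-- The concatenation of `e₁` on `[0, κ]` and `e₂` on `[κ, 1]`, where `κ` goes to `ρ`. -/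
def concat (κ ρ : ℝ) (e₁ e₂ : ℝ → ℝ) (s : ℝ) : ℝ :=
  if s ≤ κ then ρ * e₁ (s / κ) else ρ + (1 - ρ) * e₂ ((s - κ) / (1 - κ))

theorem Reparam.rev {e : ℝ → ℝ} (h : Reparam e) : Reparam (rev e) where
  zero := by simp [Penrose.rev, h.one]
  one := by simp [Penrose.rev, h.zero]
  mapsTo s hs := by
    have := h.mapsTo (x := 1 - s) ⟨by linarith [hs.2], by linarith [hs.1]⟩
    exact ⟨by unfold Penrose.rev; linarith [this.2], by unfold Penrose.rev; linarith [this.1]⟩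
  surjOn s hs := by
    obtain ⟨r, hr, e⟩ := h.surjOn (a := 1 - s) ⟨by linarith [hs.2], by linarith [hs.1]⟩
    refine ⟨1 - r, ⟨by linarith [hr.2], by linarith [hr.1]⟩, ?_⟩
    simp [Penrose.rev, e]

theorem Reparam.concat {κ ρ : ℝ} (h0 : 0 < κ) (h1 : κ < 1) (r0 : 0 < ρ) (r1 : ρ < 1)
    {e₁ e₂ : ℝ → ℝ} (h₁ : Reparam e₁) (h₂ : Reparam e₂) : Reparam (concat κ ρ e₁ e₂) where
  zero := by simp [Penrose.concat, h0.le, h₁.zero]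
  one := by
    have : 1 - κ ≠ 0 := by linarith
    simp [Penrose.concat, h1, this, h₂.one]
  mapsTo s hs := by
    unfold Penrose.concat
    split_ifs with h
    · have := h₁.mapsTo (x := s / κ) ⟨div_nonneg hs.1 h0.le, (div_le_one h0).2 h⟩
      exact ⟨mul_nonneg r0.le this.1, by nlinarith [this.2]⟩
    · have := h₂.mapsTo (x := (s - κ) / (1 - κ)) ⟨div_nonneg (by linarith) (by linarith),
        (div_le_one (by linarith)).2 (by linarith [hs.2])⟩
      exact ⟨by nlinarith [this.1], by nlinarith [this.2]⟩
  surjOn t ht := by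
    by_cases h : t ≤ ρ
    · obtain ⟨s, hs, e⟩ := h₁.surjOn (a := t / ρ) ⟨div_nonneg ht.1 r0.le, (div_le_one r0).2 h⟩
      refine ⟨κ * s, ⟨mul_nonneg h0.le hs.1, by nlinarith [hs.2]⟩, ?_⟩
      rw [Penrose.concat, if_pos (by nlinarith [hs.2]), mul_div_cancel_left₀ _ h0.ne', e]
      field_simp
    · push Not at h
      have k : 1 - κ ≠ 0 := by linarith
      have k' : 1 - ρ ≠ 0 := by linarith
      obtain ⟨s, hs, e⟩ := h₂.surjOn (a := (t - ρ) / (1 - ρ)) ⟨div_nonneg (by linarith)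
        (by linarith), (div_le_one (by linarith)).2 (by linarith [ht.2])⟩
      -- The value `s = 0` has to be excluded because `concat` treats the point `κ` by its first
      -- branch.
      have hs0 : 0 < s := by
        rcases hs.1.eq_or_lt with h' | h'
        · rw [← h', h₂.zero, eq_comm, div_eq_iff k'] at e
          linarith
        · exact h'
      have : 0 < (1 - κ) * s := mul_pos (by linarith) hs0
      refine ⟨κ + (1 - κ) * s, ⟨by linarith, by nlinarith [hs.2]⟩, ?_⟩
      rw [Penrose.concat, if_neg (by linarith), add_sub_cancel_left, mul_div_cancel_left₀ _ k, e]
      field_simp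
      ring

/-- `F` acts on the segment `[p, q]` by the reparametrization `e`. -/
def ActsOn (F : Plane → Plane) (p q : Plane) (e : ℝ → ℝ) : Prop :=
  ∀ s ∈ Set.Icc (0 : ℝ) 1, F (AffineMap.lineMap p q s) = AffineMap.lineMap p q (e s)

theorem ActsOn.rev {F : Plane → Plane} {p q : Plane} {e : ℝ → ℝ} (h : ActsOn F p q e) :
    ActsOn F q p (rev e) := by
  intro s hs
  have := h (1 - s) ⟨by linarith [hs.2], by linarith [hs.1]⟩
  rw [AffineMap.lineMap_apply_one_sub] at this
  rw [this, Penrose.rev, AffineMap.lineMap_apply_one_sub]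

theorem rev_rev (e : ℝ → ℝ) : rev (rev e) = e := by
  funext s; simp [rev]

/-- Surjectivity of `e` is enough: on the image of the segment, `G` is controlled by `G (F x) = x`.
-/
theorem SelfMap.actsOn_inv {T : Set Plane} {L : ℝ} {F G : Plane → Plane} (h : SelfMap T L F G)
    {p q : Plane} (hp : p ∈ T) (hq : q ∈ T) (hT : Convex ℝ T) {e : ℝ → ℝ} (he : Reparam e)
    (ha : ActsOn F p q e) {s : ℝ} (hs : s ∈ Set.Icc (0 : ℝ) 1) :
    ∃ r ∈ Set.Icc (0 : ℝ) 1, e r = s ∧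
      G (AffineMap.lineMap p q s) = AffineMap.lineMap p q r := by
  obtain ⟨r, hr, rfl⟩ := he.surjOn hs
  exact ⟨r, hr, rfl, by rw [← ha r hr, h.left_inv _ (hT.lineMap_mem hp hq hr)]⟩

/-! ### One step of the recursion: gluing along the cut, then sliding -/

section Step

variable {u v w : Plane} {κ ρ : ℝ}

theorem lineMap_mem_tri_left (u v w : Plane) {s : ℝ} (hs : s ∈ Set.Icc (0 : ℝ) 1) :
    AffineMap.lineMap u v s ∈ tri u v w :=
  (convex_tri u v w).lineMap_mem (left_mem_tri _ _ _) (mid_mem_tri _ _ _) hs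

theorem slide_lineMap_left (h : ar u v w ≠ 0) (h0 : 0 < κ) (h1 : κ < 1) {s : ℝ}
    (hs : s ∈ Set.Icc (0 : ℝ) 1) :
    slide κ ρ u v w (AffineMap.lineMap u (AffineMap.lineMap u v κ) s)
      = AffineMap.lineMap u v (ρ * s) := by
  rw [slide_of_mem_left h h0 h1 (lineMap_mem_tri_left _ _ _ hs)]
  have : bary v w u (AffineMap.lineMap u (AffineMap.lineMap u v κ) s) = κ * s := by
    unfold bary
    rw [ar_rotate u v w, div_eq_iff h]
    simp only [ar_eq, lineMap_coord]; ring
  rw [this]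
  ext i
  simp only [lineMap_coord, PiLp.add_apply, PiLp.smul_apply, PiLp.sub_apply, smul_eq_mul]
  field_simp
  ring

theorem slide_lineMap_right (h : ar u v w ≠ 0) (h0 : 0 < κ) (h1 : κ < 1) {s : ℝ}
    (hs : s ∈ Set.Icc (0 : ℝ) 1) :
    slide κ ρ u v w (AffineMap.lineMap (AffineMap.lineMap u v κ) v s)
      = AffineMap.lineMap u v (ρ + (1 - ρ) * s) := by
  rw [slide_of_mem_right h h0 h1 (lineMap_mem_tri_left _ _ _ hs)]
  have : bary u v w (AffineMap.lineMap (AffineMap.lineMap u v κ) v s) = (1 - κ) * (1 - s) := by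
    unfold bary
    rw [div_eq_iff h]
    simp only [ar_eq, lineMap_coord]; ring
  rw [this]
  have k : 1 - κ ≠ 0 := by linarith
  ext i
  simp only [lineMap_coord, PiLp.add_apply, PiLp.smul_apply, PiLp.sub_apply, smul_eq_mul]
  field_simp
  ring

theorem slide_lineMap_left_apex (h : ar u v w ≠ 0) (h0 : 0 < κ) (h1 : κ < 1) {s : ℝ}
    (hs : s ∈ Set.Icc (0 : ℝ) 1) :
    slide κ ρ u v w (AffineMap.lineMap u w s) = AffineMap.lineMap u w s := by
  rw [slide_of_mem_left h h0 h1
    ((convex_tri _ _ _).lineMap_mem (left_mem_tri _ _ _) (right_mem_tri _ _ _) hs)]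
  have : bary v w u (AffineMap.lineMap u w s) = 0 := by
    unfold bary
    rw [ar_rotate u v w, div_eq_iff h]
    simp only [ar_eq, lineMap_coord]; ring
  simp [this]

theorem slide_lineMap_right_apex (h : ar u v w ≠ 0) (h0 : 0 < κ) (h1 : κ < 1) {s : ℝ}
    (hs : s ∈ Set.Icc (0 : ℝ) 1) :
    slide κ ρ u v w (AffineMap.lineMap v w s) = AffineMap.lineMap v w s := by
  rw [slide_of_mem_right h h0 h1
    ((convex_tri _ _ _).lineMap_mem (mid_mem_tri _ _ _) (right_mem_tri _ _ _) hs)]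
  have : bary u v w (AffineMap.lineMap v w s) = 0 := by
    unfold bary
    rw [div_eq_iff h]
    simp only [ar_eq, lineMap_coord]; ring
  simp [this]

theorem lineMap_lineMap_left (u v : Plane) {κ : ℝ} (h0 : 0 < κ) (s : ℝ) :
    (AffineMap.lineMap u v s : Plane) = AffineMap.lineMap u (AffineMap.lineMap u v κ) (s / κ) := by
  ext i
  simp only [lineMap_coord]
  field_simp
  ring

theorem lineMap_lineMap_right (u v : Plane) {κ : ℝ} (h1 : κ < 1) (s : ℝ) :
    (AffineMap.lineMap u v s : Plane)
      = AffineMap.lineMap (AffineMap.lineMap u v κ) v ((s - κ) / (1 - κ)) := by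
  have k : 1 - κ ≠ 0 := by linarith
  ext i
  simp only [lineMap_coord]
  field_simp
  ring

/-- The maps of the two parts of a cut triangle, followed by `slide`. -/
theorem SelfMap.step {C L : ℝ} {F₁ G₁ F₂ G₂ : Plane → Plane} {e : ℝ → ℝ}
    (h : ar u v w ≠ 0) (h0 : 1 / 3 ≤ κ) (h1 : κ ≤ 2 / 3)
    (r0 : 1 / 3 ≤ ρ) (r1 : ρ ≤ 2 / 3) (hC0 : 0 ≤ C) (hL : 0 ≤ L)
    (hC : dist u v * dist u w ≤ C * |ar u v w|) (hC' : dist u v * dist v w ≤ C * |ar u v w|)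
    (h₁ : SelfMap (tri u (AffineMap.lineMap u v κ) w) L F₁ G₁)
    (h₂ : SelfMap (tri (AffineMap.lineMap u v κ) v w) L F₂ G₂) (he : Reparam e)
    (a₁ : ActsOn F₁ w (AffineMap.lineMap u v κ) e)
    (a₂ : ActsOn F₂ w (AffineMap.lineMap u v κ) e) :
    ∃ F G, SelfMap (tri u v w) ((1 + 3 * C * |ρ - κ|) * L) F G ∧
      (∀ x ∈ tri u (AffineMap.lineMap u v κ) w, F x = slide κ ρ u v w (F₁ x)) ∧
      (∀ x ∈ tri (AffineMap.lineMap u v κ) v w, F x = slide κ ρ u v w (F₂ x)) := by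
  have k0 : 0 < κ := by linarith
  have k1 : κ < 1 := by linarith
  obtain ⟨F, G, hS, f₁, f₂⟩ := SelfMap.glue h₁ h₂
    (by
      rintro x ⟨hx1, hx2⟩
      obtain ⟨s, hs, rfl⟩ := exists_lineMap_of_mem_inter h k0 k1 hx1 hx2
      rw [a₁ s hs, a₂ s hs])
    (by
      rintro x ⟨hx1, hx2⟩
      obtain ⟨s, hs, rfl⟩ := exists_lineMap_of_mem_inter h k0 k1 hx1 hx2
      -- Both maps act on the cut by the same `e`, so one parameter `r` with `e r = s` serves for
      -- both inverses.
      obtain ⟨r, hr, rfl, e1⟩ := h₁.actsOn_inv (right_mem_tri _ _ _) (mid_mem_tri _ _ _)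
        (convex_tri _ _ _) he a₁ hs
      rw [e1, ← a₂ r hr, h₂.left_inv]
      exact (convex_tri _ _ _).lineMap_mem (right_mem_tri _ _ _) (left_mem_tri _ _ _) hr)
    (fun x hx y hy => exists_cross_point h k0 k1 hx hy)
  rw [← tri_eq_union h k0 k1] at hS
  exact ⟨_, _, (selfMap_slide h h0 h1 r0 r1 hC hC').comp hS hL (by positivity),
    fun x hx => by rw [Function.comp_apply, f₁ hx], fun x hx => by rw [Function.comp_apply, f₂ hx]⟩

theorem actsOn_concat {F F₁ F₂ : Plane → Plane} {e₁ e₂ : ℝ → ℝ}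
    (h : ar u v w ≠ 0) (h0 : 0 < κ) (h1 : κ < 1)
    (f₁ : ∀ x ∈ tri u (AffineMap.lineMap u v κ) w, F x = slide κ ρ u v w (F₁ x))
    (f₂ : ∀ x ∈ tri (AffineMap.lineMap u v κ) v w, F x = slide κ ρ u v w (F₂ x))
    (he₁ : Reparam e₁) (he₂ : Reparam e₂)
    (a₁ : ActsOn F₁ u (AffineMap.lineMap u v κ) e₁)
    (a₂ : ActsOn F₂ (AffineMap.lineMap u v κ) v e₂) : ActsOn F u v (concat κ ρ e₁ e₂) := by
  intro s hs
  unfold concat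
  split_ifs with hle
  · have hs' : s / κ ∈ Set.Icc (0:ℝ) 1 := ⟨div_nonneg hs.1 h0.le, (div_le_one h0).2 hle⟩
    rw [lineMap_lineMap_left u v h0 s, f₁ _ (lineMap_mem_tri_left _ _ _ hs'), a₁ _ hs',
      slide_lineMap_left h h0 h1 (he₁.mapsTo hs')]
  · have hs' : (s - κ) / (1 - κ) ∈ Set.Icc (0:ℝ) 1 := ⟨div_nonneg (by linarith) (by linarith),
        (div_le_one (by linarith)).2 (by linarith [hs.2])⟩
    rw [lineMap_lineMap_right u v h1 s, f₂ _ (lineMap_mem_tri_left _ _ _ hs'), a₂ _ hs',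
      slide_lineMap_right h h0 h1 (he₂.mapsTo hs')]

/-- The displacement of `slide` vanishes on the side `[u, w]`, so the action of `F₁` there is
inherited unchanged. -/
theorem actsOn_left_apex {F F₁ : Plane → Plane} {e : ℝ → ℝ}
    (h : ar u v w ≠ 0) (h0 : 0 < κ) (h1 : κ < 1)
    (f₁ : ∀ x ∈ tri u (AffineMap.lineMap u v κ) w, F x = slide κ ρ u v w (F₁ x))
    (he : Reparam e) (a : ActsOn F₁ u w e) : ActsOn F u w e := by
  intro s hs
  rw [f₁ _ ((convex_tri _ _ _).lineMap_mem (left_mem_tri _ _ _) (right_mem_tri _ _ _) hs), a s hs,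
    slide_lineMap_left_apex h h0 h1 (he.mapsTo hs)]

theorem actsOn_right_apex {F F₂ : Plane → Plane} {e : ℝ → ℝ}
    (h : ar u v w ≠ 0) (h0 : 0 < κ) (h1 : κ < 1)
    (f₂ : ∀ x ∈ tri (AffineMap.lineMap u v κ) v w, F x = slide κ ρ u v w (F₂ x))
    (he : Reparam e) (a : ActsOn F₂ v w e) : ActsOn F v w e := by
  intro s hs
  rw [f₂ _ ((convex_tri _ _ _).lineMap_mem (mid_mem_tri _ _ _) (right_mem_tri _ _ _) hs), a s hs,
    slide_lineMap_right_apex h h0 h1 (he.mapsTo hs)]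

end Step

/-! ### Fibonacci ratios and the Lipschitz constants -/

theorem inv_golden_eq : (φ⁻¹ : ℝ) = φ - 1 := by
  rw [Real.inv_goldenRatio]; linarith [Real.goldenRatio_add_goldenConj]

theorem golden_lower : 8 / 5 < φ := by
  nlinarith [Real.goldenRatio_sq, Real.goldenRatio_pos]

theorem golden_upper : φ < 5 / 3 := by
  nlinarith [Real.goldenRatio_sq, Real.goldenRatio_pos]

theorem inv_golden_sq : (φ⁻¹ : ℝ) ^ 2 = 1 - φ⁻¹ := by
  rw [inv_golden_eq]; linarith [Real.goldenRatio_sq]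

/-- The ratio in which the cut side of a triangle of level `n + 3` is to be divided. -/
def ratio (n : ℕ) : ℝ := (Nat.fib (n + 2) : ℝ) / Nat.fib (n + 3)

theorem fib_pos' (n : ℕ) : (0 : ℝ) < Nat.fib (n + 1) := by
  exact_mod_cast Nat.fib_pos.2 (Nat.succ_pos n)

theorem fib_rec (n : ℕ) : (Nat.fib (n + 2) : ℝ) = Nat.fib n + Nat.fib (n + 1) := by
  exact_mod_cast Nat.fib_add_two

theorem one_sub_ratio (n : ℕ) : 1 - ratio n = (Nat.fib (n + 1) : ℝ) / Nat.fib (n + 3) := by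
  have := fib_pos' (n + 2)
  unfold ratio
  rw [eq_div_iff this.ne', sub_mul, div_mul_cancel₀ _ this.ne', fib_rec (n + 1)]
  ring

theorem ratio_lower (n : ℕ) : 1 / 3 ≤ ratio n := by
  have := fib_pos' (n + 2)
  unfold ratio
  rw [le_div_iff₀ this]
  have : (Nat.fib (n + 1) : ℝ) ≤ Nat.fib (n + 2) := by exact_mod_cast Nat.fib_mono (by omega)
  linarith [fib_rec (n + 1), fib_pos' (n + 1)]

theorem ratio_upper (n : ℕ) : ratio n ≤ 2 / 3 := by
  have h := one_sub_ratio n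
  have h3 := fib_pos' (n + 2)
  have : 1 / 3 ≤ (Nat.fib (n + 1) : ℝ) / Nat.fib (n + 3) := by
    rw [le_div_iff₀ h3]
    have : (Nat.fib n : ℝ) ≤ Nat.fib (n + 1) := by exact_mod_cast Nat.fib_mono (by omega)
    linarith [fib_rec (n + 1), fib_rec n]
  linarith

/-- The difference `fib (m + 1) - φ * fib m` is the `m`-th power of the conjugate of `φ`, whose
absolute value is `φ⁻¹`; here `m = n + 2`. -/
theorem abs_ratio_sub_le (n : ℕ) : |ratio n - φ⁻¹| ≤ (φ⁻¹ : ℝ) ^ (n + 2) := by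
  have h := Real.fib_succ_sub_goldenRatio_mul_fib (n + 2)
  have h3 := fib_pos' (n + 2)
  have hφ := Real.goldenRatio_pos
  have e : ratio n - φ⁻¹ = -(Real.goldenConj ^ (n + 2) / (φ * Nat.fib (n + 3))) := by
    rw [← h]
    unfold ratio
    field_simp
    ring
  have h1 : (1 : ℝ) ≤ φ * Nat.fib (n + 3) := by
    have : (1 : ℝ) ≤ Nat.fib (n + 3) := by exact_mod_cast Nat.fib_pos.2 (Nat.succ_pos (n + 2))
    nlinarith [Real.one_lt_goldenRatio]
  rw [e, abs_neg, abs_div, abs_of_pos (by positivity : 0 < φ * (Nat.fib (n + 3) : ℝ)), abs_pow,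
    abs_of_neg Real.goldenConj_neg, ← Real.inv_goldenRatio]
  exact div_le_self (by positivity) h1

/-- The bound for the Lipschitz constants at level `n`. -/
def lipConst (n : ℕ) : ℝ := Real.exp (6 * ∑ j ∈ Finset.range n, (φ⁻¹ : ℝ) ^ j)

theorem lipConst_pos (n : ℕ) : 0 < lipConst n := Real.exp_pos _

theorem lipConst_mono {m n : ℕ} (h : m ≤ n) : lipConst m ≤ lipConst n := by
  have := Real.goldenRatio_pos
  refine Real.exp_le_exp.2 (mul_le_mul_of_nonneg_left ?_ (by norm_num))
  exact Finset.sum_le_sum_of_subset_of_nonneg (Finset.range_mono h) fun i _ _ => by positivity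

theorem one_le_lipConst (n : ℕ) : 1 ≤ lipConst n := by
  simpa [lipConst] using lipConst_mono (Nat.zero_le n)

/-- This is `1 + x ≤ exp x`. The 6 is the factor `3 * C` in the Lipschitz bound of `slide`, with `C
= 2` from `Shape.fat`. -/
theorem lipConst_succ (n : ℕ) {δ : ℝ} (h : δ ≤ (φ⁻¹ : ℝ) ^ n) :
    (1 + 6 * δ) * lipConst n ≤ lipConst (n + 1) := by
  unfold lipConst
  rw [Finset.sum_range_succ, mul_add, add_comm, Real.exp_add, mul_comm, mul_comm (Real.exp _)]
  rw [mul_comm]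
  gcongr
  have := Real.add_one_le_exp (6 * (φ⁻¹ : ℝ) ^ n)
  linarith

theorem lipConst_le (n : ℕ) : lipConst n ≤ Real.exp (6 * (1 - φ⁻¹)⁻¹) := by
  have h0 := Real.goldenRatio_pos
  have h1 : (φ⁻¹ : ℝ) < 1 := inv_lt_one_of_one_lt₀ Real.one_lt_goldenRatio
  refine Real.exp_le_exp.2 (mul_le_mul_of_nonneg_left ?_ (by norm_num))
  rw [← tsum_geometric_of_lt_one (by positivity) h1]
  exact (summable_geometric_of_lt_one (by positivity) h1).sum_le_tsum _
    fun i _ => by positivity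

/-! ### Golden triangles and their golden cuts -/

/-- The golden triangles: acute (`true`, apex `u`) and obtuse (`false`, apex `w`). The side
`[u, v]` is the one that is cut. -/
def Shape : Bool → Plane → Plane → Plane → Prop
  | true, u, v, w => 0 < dist v w ∧ dist u v = φ * dist v w ∧ dist u w = φ * dist v w
  | false, u, v, w => 0 < dist u w ∧ dist v w = dist u w ∧ dist u v = φ * dist u w

/-- For a golden triangle with shorter side `d`, Heron's formula makes `4 * ar u v w ^ 2` equal to
`(φ + 2) * d ^ 4` in the obtuse case and `(4 * φ + 3) * d ^ 4` in the acute case. The squares to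
compare with are `φ ^ 2 * d ^ 4 = (φ + 1) * d ^ 4` and `φ ^ 4 * d ^ 4 = (3 * φ + 2) * d ^ 4`. -/
theorem Shape.fat {r : Bool} {u v w : Plane} (h : Shape r u v w) : ar u v w ≠ 0 ∧
    dist u v * dist u w ≤ 2 * |ar u v w| ∧ dist u v * dist v w ≤ 2 * |ar u v w| := by
  have hq := Real.goldenRatio_sq
  have hl := golden_lower
  have hu := golden_upper
  have har := ar_sq u v w
  have e4 : φ ^ 4 = 3 * φ + 2 := by
    generalize Real.goldenRatio = g at hq
    linear_combination (g ^ 2 + g + 2) * hq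
  cases r
  · obtain ⟨hd, h1, h2⟩ := h
    generalize Real.goldenRatio = g at *
    have hg : 0 < g := by linarith
    generalize dist u w = d at *
    rw [h1, h2] at har
    have e : 4 * ar u v w ^ 2 = (4 * g ^ 2 - g ^ 4) * d ^ 4 := by rw [har]; ring
    rw [e4, hq] at e
    have hd4 : 0 < d ^ 4 := by positivity
    have hA : (g * d * d) ^ 2 ≤ (2 * |ar u v w|) ^ 2 := by
      rw [mul_pow 2, sq_abs]
      have : (g * d * d) ^ 2 = g ^ 2 * d ^ 4 := by ring
      rw [this, hq]; nlinarith
    have hB := (abs_le.1 (abs_le_of_sq_le_sq hA (by positivity))).2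
    have hne : ar u v w ≠ 0 := by
      intro h0; rw [h0] at e; nlinarith
    rw [h1, h2]
    exact ⟨hne, hB, hB⟩
  · obtain ⟨hd, h1, h2⟩ := h
    generalize Real.goldenRatio = g at *
    have hg : 0 < g := by linarith
    generalize dist v w = d at *
    rw [h1, h2] at har
    have e : 4 * ar u v w ^ 2 = (4 * g ^ 2 - 1) * d ^ 4 := by rw [har]; ring
    rw [hq] at e
    have hd4 : 0 < d ^ 4 := by positivity
    have hA : (g * d * (g * d)) ^ 2 ≤ (2 * |ar u v w|) ^ 2 := by
      rw [mul_pow 2, sq_abs]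
      have : (g * d * (g * d)) ^ 2 = g ^ 4 * d ^ 4 := by ring
      rw [this, e4]; nlinarith
    have hB := (abs_le.1 (abs_le_of_sq_le_sq hA (by positivity))).2
    have hne : ar u v w ≠ 0 := by
      intro h0; rw [h0] at e; nlinarith
    rw [h1, h2]
    refine ⟨hne, hB, le_trans ?_ hB⟩
    gcongr
    nlinarith

theorem Shape.ar_ne_zero {r : Bool} {u v w : Plane} (h : Shape r u v w) : ar u v w ≠ 0 := h.fat.1

/-- Stewart's theorem. -/
theorem dist_sq_lineMap (u v w : Plane) (κ : ℝ) :
    dist w (AffineMap.lineMap u v κ) ^ 2 =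
      (1 - κ) * dist u w ^ 2 + κ * dist v w ^ 2 - κ * (1 - κ) * dist u v ^ 2 := by
  simp only [dist_eq_norm, norm_sq_eq_coords, PiLp.sub_apply, lineMap_coord]
  ring

theorem dist_cut_left (u v : Plane) : dist u (HalfTile.cut u v) = φ⁻¹ * dist u v := by
  have := Real.goldenRatio_pos
  rw [HalfTile.cut, dist_left_lineMap, Real.norm_of_nonneg (by positivity)]

theorem dist_cut_right (u v : Plane) : dist v (HalfTile.cut u v) = (φ⁻¹) ^ 2 * dist u v := by
  rw [HalfTile.cut, dist_comm, dist_lineMap_right, inv_golden_sq, Real.norm_of_nonneg]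
  rw [← inv_golden_sq]; positivity

theorem Shape.dist_apex_true {u v w : Plane} (h : Shape true u v w) :
    dist w (HalfTile.cut u v) = dist v w := by
  obtain ⟨hd, h1, h2⟩ := h
  have hq := Real.goldenRatio_sq
  rw [← sq_eq_sq₀ dist_nonneg dist_nonneg, HalfTile.cut, dist_sq_lineMap, h1, h2, inv_golden_eq]
  generalize Real.goldenRatio = g at hq
  linear_combination (g ^ 2 - 3 * g + 2) * dist v w ^ 2 * hq

theorem Shape.dist_apex_false {u v w : Plane} (h : Shape false u v w) :
    dist w (HalfTile.cut u v) = φ⁻¹ * dist u w := by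
  obtain ⟨hd, h1, h2⟩ := h
  have hq := Real.goldenRatio_sq
  have hφ := Real.goldenRatio_pos
  rw [← sq_eq_sq₀ dist_nonneg (by positivity), HalfTile.cut, dist_sq_lineMap, h1, h2,
    inv_golden_eq]
  generalize Real.goldenRatio = g at hq
  linear_combination (g ^ 2 - 2 * g) * dist u w ^ 2 * hq

/-- The two parts of a golden triangle are golden triangles. -/
theorem Shape.true_cut {u v w : Plane} (h : Shape true u v w) :
    Shape false w u (HalfTile.cut u v) ∧ Shape true w (HalfTile.cut u v) v := by
  have hφ := Real.goldenRatio_pos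
  have e1 := h.dist_apex_true
  have e2 := dist_cut_left u v
  have e3 := dist_cut_right u v
  obtain ⟨hd, h1, h2⟩ := h
  rw [h1, inv_mul_cancel_left₀ hφ.ne'] at e2
  have e3' : dist (HalfTile.cut u v) v = φ⁻¹ * dist v w := by
    rw [dist_comm, e3, h1, sq, mul_assoc, inv_mul_cancel_left₀ hφ.ne']
  refine ⟨⟨by rw [e1]; exact hd, by rw [e1, e2], by rw [e1, dist_comm, h2]⟩, ?_, ?_, ?_⟩
  · rw [e3']; positivity
  · rw [e1, e3', mul_inv_cancel_left₀ hφ.ne']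
  · rw [e3', mul_inv_cancel_left₀ hφ.ne', dist_comm]

theorem Shape.false_cut {u v w : Plane} (h : Shape false u v w) :
    Shape true u w (HalfTile.cut u v) ∧ Shape false v w (HalfTile.cut u v) := by
  have hφ := Real.goldenRatio_pos
  have e1 := h.dist_apex_false
  have e2 := dist_cut_left u v
  have e3 := dist_cut_right u v
  obtain ⟨hd, h1, h2⟩ := h
  rw [h2, inv_mul_cancel_left₀ hφ.ne'] at e2
  have e3' : dist v (HalfTile.cut u v) = φ⁻¹ * dist u w := by
    rw [e3, h2, sq, mul_assoc, inv_mul_cancel_left₀ hφ.ne']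
  refine ⟨⟨by rw [e1]; positivity, by rw [e1, mul_inv_cancel_left₀ hφ.ne'],
    by rw [e1, e2, mul_inv_cancel_left₀ hφ.ne']⟩, by rw [e3']; positivity, by rw [e1, e3'], ?_⟩
  rw [h1, e3', mul_inv_cancel_left₀ hφ.ne']

/-! ### Dissections by level and the equalizing maps -/

/-- The reparametrizations of the sides of the triangles; the side `[u, v]` of a triangle of
level `n` has index `n + 2`. -/
def edgeMap : Bool → ℕ → ℝ → ℝ
  -- Index `j + 5` belongs to the cut side of a triangle of level `j + 3`, hence `ratio j`. The two
  -- arguments are the actions of the parts on their shares of that side.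
  | true, j + 5 => concat φ⁻¹ (ratio j) (edgeMap false (j + 2)) (edgeMap false j)
  -- In the obtuse case both parts list their shares of the side in the opposite direction.
  | false, j + 5 => concat φ⁻¹ (ratio j) (rev (edgeMap false (j + 3))) (rev (edgeMap true (j + 2)))
  | _, _ => id

theorem edgeMap_of_lt {r : Bool} {j : ℕ} (h : j < 5) : edgeMap r j = id := by
  unfold edgeMap
  split <;> first | rfl | omega

theorem inv_golden_bounds : 1 / 3 ≤ (φ⁻¹ : ℝ) ∧ (φ⁻¹ : ℝ) ≤ 2 / 3 := by
  rw [inv_golden_eq]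
  constructor
  · linarith [golden_lower]
  · linarith [golden_upper]

theorem reparam_id : Reparam id := ⟨rfl, rfl, fun _ h => h, fun x h => ⟨x, h, rfl⟩⟩

theorem reparam_edgeMap (j : ℕ) : ∀ r, Reparam (edgeMap r j) := by
  obtain ⟨k0, k1⟩ := inv_golden_bounds
  induction j using Nat.strong_induction_on with
  | _ j ih =>
    intro r
    rcases lt_or_ge j 5 with h | h
    · rw [edgeMap_of_lt h]; exact reparam_id
    · obtain ⟨i, rfl⟩ := Nat.exists_eq_add_of_le' h
      have r0 := ratio_lower i
      have r1 := ratio_upper i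
      cases r
      · rw [edgeMap]
        exact .concat (by linarith) (by linarith) (by linarith) (by linarith)
          (ih _ (by omega) _).rev (ih _ (by omega) _).rev
      · rw [edgeMap]
        exact .concat (by linarith) (by linarith) (by linarith) (by linarith)
          (ih _ (by omega) _) (ih _ (by omega) _)

/-- The half tiles into which the golden triangle `u v w` of level `n` is dissected. -/
def leaves : ℕ → Bool → Plane → Plane → Plane → Set HalfTile
  | 0, _, _, _, _ => ∅
  | 1, true, u, v, w => {⟨.halfThin, u, v, w⟩}
  | 1, false, u, v, w => {⟨.halfDart, v, w, u⟩}
  | 2, true, u, v, w => {⟨.halfKite, w, u, v⟩}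
  | 2, false, u, v, w => {⟨.halfThick, w, u, v⟩}
  | n + 3, true, u, v, w =>
      leaves (n + 2) false w u (HalfTile.cut u v) ∪ leaves (n + 1) true w (HalfTile.cut u v) v
  | n + 3, false, u, v, w =>
      leaves (n + 2) true u w (HalfTile.cut u v) ∪ leaves (n + 1) false v w (HalfTile.cut u v)

/-- The action of a map on the sides of a golden triangle of level `n`. -/
def SideActs (F : Plane → Plane) (n : ℕ) : Bool → Plane → Plane → Plane → Prop
  | true, u, v, w => ActsOn F u v (edgeMap true (n + 2)) ∧ ActsOn F w u (edgeMap false (n + 1)) ∧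
      -- Levels in use are positive, so the subtraction is not truncated.
      ActsOn F v w (edgeMap false (n - 1))
  | false, u, v, w => ActsOn F u v (edgeMap false (n + 2)) ∧ ActsOn F u w (edgeMap true (n + 1)) ∧
      ActsOn F v w (edgeMap false n)

/-- `F` is affine on the triangle `a b c`. -/
def AffineOn (F : Plane → Plane) (a b c : Plane) : Prop :=
  ∀ α β γ : ℝ, 0 ≤ α → 0 ≤ β → 0 ≤ γ → α + β + γ = 1 →
    F (α • a + β • b + γ • c) = α • F a + β • F b + γ • F c

theorem tri_rotate' (u v w : Plane) : tri w u v = tri u v w := by rw [tri_rotate v w u, tri_rotate]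

theorem ar_rotate' (u v w : Plane) : ar w u v = ar u v w := by rw [ar_rotate v w u, ar_rotate]

theorem tri_subset {T : Set Plane} (hT : Convex ℝ T) {a b c : Plane} (ha : a ∈ T) (hb : b ∈ T)
    (hc : c ∈ T) : tri a b c ⊆ T :=
  convexHull_min (by rintro _ (rfl | rfl | rfl) <;> assumption) hT

theorem cut_mem_tri (u v w : Plane) : HalfTile.cut u v ∈ tri u v w :=
  lineMap_mem_tri_left u v w ⟨by linarith [inv_golden_bounds.1], by linarith [inv_golden_bounds.2]⟩

theorem tri_cut_left_subset (u v w : Plane) : tri u (HalfTile.cut u v) w ⊆ tri u v w :=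
  tri_subset (convex_tri _ _ _) (left_mem_tri _ _ _) (cut_mem_tri _ _ _) (right_mem_tri _ _ _)

theorem tri_cut_right_subset (u v w : Plane) : tri (HalfTile.cut u v) v w ⊆ tri u v w :=
  tri_subset (convex_tri _ _ _) (cut_mem_tri _ _ _) (mid_mem_tri _ _ _) (right_mem_tri _ _ _)

theorem leaves_region_subset (n : ℕ) : ∀ (r : Bool) (u v w : Plane), ∀ t ∈ leaves n r u v w,
    t.region ⊆ tri u v w := by
  induction n using Nat.strong_induction_on with
  | _ n ih =>
    intro r u v w t ht
    match n, r with
    | 0, _ => simp [leaves] at ht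
    | 1, true => simp only [leaves, Set.mem_singleton_iff] at ht; subst ht; exact subset_rfl
    | 1, false =>
      simp only [leaves, Set.mem_singleton_iff] at ht; subst ht
      exact (tri_rotate u v w).subset
    | 2, true =>
      simp only [leaves, Set.mem_singleton_iff] at ht; subst ht
      exact (tri_rotate' u v w).subset
    | 2, false =>
      simp only [leaves, Set.mem_singleton_iff] at ht; subst ht
      exact (tri_rotate' u v w).subset
    | n + 3, true =>
      rw [leaves] at ht
      rcases ht with ht | ht
      · exact (ih _ (by omega) _ _ _ _ t ht).trans
          ((tri_rotate' u _ w).subset.trans (tri_cut_left_subset u v w))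
      · exact (ih _ (by omega) _ _ _ _ t ht).trans
          ((tri_rotate' _ v w).subset.trans (tri_cut_right_subset u v w))
    | n + 3, false =>
      rw [leaves] at ht
      rcases ht with ht | ht
      · exact (ih _ (by omega) _ _ _ _ t ht).trans
          ((tri_swap u _ w).subset.trans (tri_cut_left_subset u v w))
      · exact (ih _ (by omega) _ _ _ _ t ht).trans
          ((tri_rotate _ v w).subset.trans (tri_cut_right_subset u v w))

theorem AffineOn.id (a b c : Plane) : AffineOn id a b c := fun _ _ _ _ _ _ _ => rfl

section LeafStep

variable {u v w : Plane} {κ ρ N N₁ : ℝ} {F F₁ : Plane → Plane} {a b c : Plane}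

/-- On this part `slide` multiplies areas by `ρ / κ`. With `T = |ar u v w|`, the value `κ * T / N₁`
attained in the part becomes `ρ * T / N₁`, which is `T / N` because `ρ * N = N₁`. -/
theorem affine_step_left (h : ar u v w ≠ 0) (h0 : 0 < κ) (h1 : κ < 1)
    (f₁ : ∀ x ∈ tri u (AffineMap.lineMap u v κ) w, F x = slide κ ρ u v w (F₁ x))
    (hm : Set.MapsTo F₁ (tri u (AffineMap.lineMap u v κ) w) (tri u (AffineMap.lineMap u v κ) w))
    (ht : tri a b c ⊆ tri u (AffineMap.lineMap u v κ) w) (hN : ρ * N = N₁)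
    (hA : AffineOn F₁ a b c ∧
      ar (F₁ a) (F₁ b) (F₁ c) * |ar a b c| * N₁ = ar a b c * (κ * |ar u v w|)) :
    AffineOn F a b c ∧ ar (F a) (F b) (F c) * |ar a b c| * N = ar a b c * |ar u v w| := by
  have ha := ht (left_mem_tri a b c)
  have hb := ht (mid_mem_tri a b c)
  have hc := ht (right_mem_tri a b c)
  obtain ⟨s1, s2⟩ := slide_affine_left (κ' := ρ) h h0 h1 (hm ha) (hm hb) (hm hc)
  constructor
  · intro α β γ hα hβ hγ hs
    rw [f₁ _ (ht (mem_tri.2 ⟨α, β, γ, hα, hβ, hγ, hs, rfl⟩)), f₁ a ha, f₁ b hb, f₁ c hc,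
      hA.1 α β γ hα hβ hγ hs, s1 α β γ hα hβ hγ hs]
  · rw [f₁ a ha, f₁ b hb, f₁ c hc, s2]
    have := hA.2
    rw [← hN] at this
    field_simp
    linarith

theorem affine_step_right (h : ar u v w ≠ 0) (h0 : 0 < κ) (h1 : κ < 1)
    (f₁ : ∀ x ∈ tri (AffineMap.lineMap u v κ) v w, F x = slide κ ρ u v w (F₁ x))
    (hm : Set.MapsTo F₁ (tri (AffineMap.lineMap u v κ) v w) (tri (AffineMap.lineMap u v κ) v w))
    (ht : tri a b c ⊆ tri (AffineMap.lineMap u v κ) v w) (hN : (1 - ρ) * N = N₁)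
    (hA : AffineOn F₁ a b c ∧
      ar (F₁ a) (F₁ b) (F₁ c) * |ar a b c| * N₁ = ar a b c * ((1 - κ) * |ar u v w|)) :
    AffineOn F a b c ∧ ar (F a) (F b) (F c) * |ar a b c| * N = ar a b c * |ar u v w| := by
  have ha := ht (left_mem_tri a b c)
  have hb := ht (mid_mem_tri a b c)
  have hc := ht (right_mem_tri a b c)
  obtain ⟨s1, s2⟩ := slide_affine_right (κ' := ρ) h h0 h1 (hm ha) (hm hb) (hm hc)
  constructor
  · intro α β γ hα hβ hγ hs
    rw [f₁ _ (ht (mem_tri.2 ⟨α, β, γ, hα, hβ, hγ, hs, rfl⟩)), f₁ a ha, f₁ b hb, f₁ c hc,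
      hA.1 α β γ hα hβ hγ hs, s1 α β γ hα hβ hγ hs]
  · rw [f₁ a ha, f₁ b hb, f₁ c hc, s2]
    have := hA.2
    rw [← hN] at this
    have k : 1 - κ ≠ 0 := by linarith
    field_simp
    linarith

end LeafStep

theorem abs_ar_cut_left (u v w : Plane) : |ar u (HalfTile.cut u v) w| = φ⁻¹ * |ar u v w| := by
  have := Real.goldenRatio_pos
  rw [HalfTile.cut, ar_lineMap_left, abs_mul, abs_of_nonneg (by positivity)]

theorem abs_ar_cut_right (u v w : Plane) :
    |ar (HalfTile.cut u v) v w| = (1 - φ⁻¹) * |ar u v w| := by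
  rw [HalfTile.cut, ar_lineMap_right, abs_mul, abs_of_nonneg]
  linarith [inv_golden_bounds.2]

theorem ratio_mul_fib (n : ℕ) : ratio n * (Nat.fib (n + 3) : ℝ) = Nat.fib (n + 2) :=
  div_mul_cancel₀ _ (fib_pos' (n + 2)).ne'

theorem one_sub_ratio_mul_fib (n : ℕ) :
    (1 - ratio n) * (Nat.fib (n + 3) : ℝ) = Nat.fib (n + 1) := by
  rw [one_sub_ratio]; exact div_mul_cancel₀ _ (fib_pos' (n + 2)).ne'

theorem sideActs_id {n : ℕ} (hn : n < 3) (r : Bool) (u v w : Plane) : SideActs id n r u v w := by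
  have key : ∀ (p q : Plane) (r : Bool) (j : ℕ), j < 5 → ActsOn id p q (edgeMap r j) := by
    intro p q r j hj s _
    rw [edgeMap_of_lt hj]; rfl
  cases r
  · exact ⟨key _ _ _ _ (by omega), key _ _ _ _ (by omega), key _ _ _ _ (by omega)⟩
  · exact ⟨key _ _ _ _ (by omega), key _ _ _ _ (by omega), key _ _ _ _ (by omega)⟩

/-- What is required of the map of a golden triangle of level `n`: the half tiles are mapped
affinely, with orientation preserved, to triangles of one and the same area. -/
structure IsEqualizer (n : ℕ) (r : Bool) (u v w : Plane) (F G : Plane → Plane) : Prop where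
  selfMap : SelfMap (tri u v w) (lipConst n) F G
  sides : SideActs F n r u v w
  leaf : ∀ t ∈ leaves n r u v w, AffineOn F t.a t.b t.c ∧
    ar (F t.a) (F t.b) (F t.c) * |ar t.a t.b t.c| * Nat.fib n = ar t.a t.b t.c * |ar u v w|

theorem IsEqualizer.base {n : ℕ} (h1 : 1 ≤ n) (h2 : n < 3) (r : Bool) (u v w : Plane) :
    IsEqualizer n r u v w id id where
  selfMap := SelfMap.id.mono (one_le_lipConst n)
  sides := sideActs_id h2 r u v w
  leaf t ht := by
    refine ⟨AffineOn.id _ _ _, ?_⟩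
    have hfib : Nat.fib n = 1 := by interval_cases n <;> rfl
    have : ar t.a t.b t.c = ar u v w := by
      interval_cases n <;> cases r <;> simp only [leaves, Set.mem_singleton_iff] at ht <;> subst ht
      · exact ar_rotate u v w
      · rfl
      · exact ar_rotate' u v w
      · exact ar_rotate' u v w
    simp [this, hfib]

/-- Induction on the level. The parts are equalized separately, which leaves the area per half tile
of one part different from that of the other. Moving the cut from the golden section to `ratio n`
makes the areas of the parts proportional to their numbers of half tiles. -/
theorem exists_isEqualizer (n : ℕ) : ∀ (r : Bool) (u v w : Plane), 1 ≤ n → Shape r u v w →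
    ∃ F G, IsEqualizer n r u v w F G := by
  obtain ⟨k0, k1⟩ := inv_golden_bounds
  have k0' : (0 : ℝ) < φ⁻¹ := by linarith
  have k1' : (φ⁻¹ : ℝ) < 1 := by linarith
  induction n using Nat.strong_induction_on with
  | _ n ih =>
    intro r u v w hn hS
    rcases lt_or_ge n 3 with h | h
    · exact ⟨id, id, .base hn h r u v w⟩
    obtain ⟨n, rfl⟩ := Nat.exists_eq_add_of_le' h
    obtain ⟨hne, hC, hC'⟩ := hS.fat
    have r0 := ratio_lower n
    have r1 := ratio_upper n
    have hL : (1 + 3 * 2 * |ratio n - φ⁻¹|) * lipConst (n + 2) ≤ lipConst (n + 3) := by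
      have := lipConst_succ (n + 2) (abs_ratio_sub_le n)
      calc _ = (1 + 6 * |ratio n - φ⁻¹|) * lipConst (n + 2) := by ring
        _ ≤ _ := this
    have hmono : lipConst (n + 1) ≤ lipConst (n + 2) := lipConst_mono (by omega)
    have hE := reparam_edgeMap
    cases r
    · obtain ⟨S₁, S₂⟩ := hS.false_cut
      obtain ⟨F₁, G₁, h₁⟩ := ih (n + 2) (by omega) true _ _ _ (by omega) S₁
      obtain ⟨F₂, G₂, h₂⟩ := ih (n + 1) (by omega) false _ _ _ (by omega) S₂
      have M₁ := h₁.selfMap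
      have M₂ := h₂.selfMap.mono hmono
      rw [tri_swap] at M₁
      rw [tri_rotate] at M₂
      obtain ⟨p1, p2, p3⟩ := h₁.sides
      obtain ⟨q1, q2, q3⟩ := h₂.sides
      -- The cut `[w, cut u v]` is a side of both parts, with the same type, index and direction:
      -- this is what `p3` and `q3` say.
      obtain ⟨F, G, hFG, f₁, f₂⟩ := SelfMap.step (e := edgeMap false (n + 1)) hne k0 k1 r0 r1
        (by norm_num) (lipConst_pos _).le hC hC' M₁ M₂ (hE _ _) p3 q3
      refine ⟨F, G, hFG.mono hL, ⟨?_, ?_, ?_⟩, ?_⟩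
      · show ActsOn F u v (edgeMap false (n + 5))
        rw [edgeMap]
        refine actsOn_concat hne k0' k1' f₁ f₂ (hE _ _).rev (hE _ _).rev ?_ ?_
        · exact p2.rev
        · exact q2.rev
      · exact actsOn_left_apex hne k0' k1' f₁ (hE _ _) p1
      · exact actsOn_right_apex hne k0' k1' f₂ (hE _ _) q1
      · intro t ht
        rw [leaves] at ht
        rcases ht with ht | ht
        · have := h₁.leaf t ht
          rw [ar_swap u _ w, abs_neg, abs_ar_cut_left] at this
          exact affine_step_left hne k0' k1' f₁ M₁.mapsTo
            ((leaves_region_subset _ _ _ _ _ t ht).trans (tri_swap u _ w).subset)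
            (ratio_mul_fib n) this
        · have := h₂.leaf t ht
          rw [ar_rotate _ v w, abs_ar_cut_right] at this
          exact affine_step_right hne k0' k1' f₂ M₂.mapsTo
            ((leaves_region_subset _ _ _ _ _ t ht).trans (tri_rotate _ v w).subset)
            (one_sub_ratio_mul_fib n) this
    · obtain ⟨S₁, S₂⟩ := hS.true_cut
      obtain ⟨F₁, G₁, h₁⟩ := ih (n + 2) (by omega) false _ _ _ (by omega) S₁
      obtain ⟨F₂, G₂, h₂⟩ := ih (n + 1) (by omega) true _ _ _ (by omega) S₂
      have M₁ := h₁.selfMap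
      have M₂ := h₂.selfMap.mono hmono
      rw [tri_rotate'] at M₁
      rw [tri_rotate'] at M₂
      obtain ⟨p1, p2, p3⟩ := h₁.sides
      obtain ⟨q1, q2, q3⟩ := h₂.sides
      obtain ⟨F, G, hFG, f₁, f₂⟩ := SelfMap.step (e := edgeMap true (n + 3)) hne k0 k1 r0 r1
        (by norm_num) (lipConst_pos _).le hC hC' M₁ M₂ (hE _ _) p2 q1
      refine ⟨F, G, hFG.mono hL, ⟨?_, ?_, ?_⟩, ?_⟩
      · show ActsOn F u v (edgeMap true (n + 5))
        rw [edgeMap]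
        refine actsOn_concat hne k0' k1' f₁ f₂ (hE _ _) (hE _ _) ?_ ?_
        · exact p3
        · exact q3
      -- This side is listed from `w` to `u`, while the lemma runs from `u` to `w`; hence the two
      -- reversals.
      · have := (actsOn_left_apex hne k0' k1' f₁ (hE _ _).rev p1.rev).rev
        rwa [rev_rev] at this
      · have := (actsOn_right_apex hne k0' k1' f₂ (hE _ _) q2)
        exact this
      · intro t ht
        rw [leaves] at ht
        rcases ht with ht | ht
        · have := h₁.leaf t ht
          rw [ar_rotate' u _ w, abs_ar_cut_left] at this
          exact affine_step_left hne k0' k1' f₁ M₁.mapsTo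
            ((leaves_region_subset _ _ _ _ _ t ht).trans (tri_rotate' u _ w).subset)
            (ratio_mul_fib n) this
        · have := h₂.leaf t ht
          rw [ar_rotate' _ v w, abs_ar_cut_right] at this
          exact affine_step_right hne k0' k1' f₂ M₂.mapsTo
            ((leaves_region_subset _ _ _ _ _ t ht).trans (tri_rotate' _ v w).subset)
            (one_sub_ratio_mul_fib n) this

/-! ### The substitution as iterated golden cuts -/

/-- `descendants` substitutes at the last generation, while `leaves` recurses from the top;
splitting off the first generation reconciles them. -/
theorem descendants_succ (m : ℕ) : ∀ s t : HalfTile,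
    t ∈ s.descendants (m + 1) → ∃ c ∈ s.children, t ∈ c.descendants m := by
  induction m with
  | zero =>
    rintro s t ⟨c, hc, ht⟩
    obtain rfl : c = s := hc
    exact ⟨t, ht, rfl⟩
  | succ m ih =>
    rintro s t ⟨p, hp, ht⟩
    obtain ⟨c, hc, hp'⟩ := ih s p hp
    exact ⟨c, hc, p, hp', ht⟩

theorem leaves_true (n : ℕ) (u v w : Plane) : leaves (n + 3) true u v w =
    leaves (n + 2) false w u (HalfTile.cut u v) ∪ leaves (n + 1) true w (HalfTile.cut u v) v := by
  rw [leaves]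

theorem leaves_false (n : ℕ) (u v w : Plane) : leaves (n + 3) false u v w =
    leaves (n + 2) true u w (HalfTile.cut u v) ∪ leaves (n + 1) false v w (HalfTile.cut u v) := by
  rw [leaves]

/-- The level, the type and the vertices, in the order of the dissection, of the golden triangle
that a half tile to be substituted `m` times is. -/
theorem descendants_subset_leaves (m : ℕ) : ∀ a b c : Plane,
    HalfTile.descendants ⟨.halfKite, a, b, c⟩ m ⊆ leaves (2 * m + 2) true b c a ∧
    HalfTile.descendants ⟨.halfDart, a, b, c⟩ m ⊆ leaves (2 * m + 1) false c a b ∧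
    HalfTile.descendants ⟨.halfThin, a, b, c⟩ m ⊆ leaves (2 * m + 1) true a b c ∧
    HalfTile.descendants ⟨.halfThick, a, b, c⟩ m ⊆ leaves (2 * m + 2) false b c a := by
  induction m with
  | zero =>
    intro a b c
    simp [HalfTile.descendants, leaves]
  | succ m ih =>
    intro a b c
    -- A substitution raises the level by two. At level `2 * m + 3` one cut does it; at level `2 * m
    -- + 4` the larger part is cut once more.
    have e1 : 2 * (m + 1) + 1 = 2 * m + 3 := by ring
    have e2 : 2 * (m + 1) + 2 = 2 * m + 1 + 3 := by ring
    rw [e1, e2]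
    have eT := leaves_true (2 * m)
    have eF := leaves_false (2 * m)
    have eT' := leaves_true (2 * m + 1)
    have eF' := leaves_false (2 * m + 1)
    refine ⟨?_, ?_, ?_, ?_⟩ <;> intro t ht <;> obtain ⟨d, hd, hdt⟩ := descendants_succ m _ _ ht <;>
      simp only [HalfTile.children, List.mem_cons, List.not_mem_nil, or_false] at hd
    · rw [eT', eF]
      rcases hd with rfl | rfl | rfl
      · exact Or.inl (Or.inr ((ih _ _ _).2.1 hdt))
      · exact Or.inl (Or.inl ((ih _ _ _).1 hdt))
      · exact Or.inr ((ih _ _ _).1 hdt)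
    · rw [eF]
      rcases hd with rfl | rfl
      · exact Or.inr ((ih _ _ _).2.1 hdt)
      · exact Or.inl ((ih _ _ _).1 hdt)
    · rw [eT]
      rcases hd with rfl | rfl
      · exact Or.inr ((ih _ _ _).2.2.1 hdt)
      · exact Or.inl ((ih _ _ _).2.2.2 hdt)
    · rw [eF', eT]
      rcases hd with rfl | rfl | rfl
      · exact Or.inr ((ih _ _ _).2.2.2 hdt)
      · exact Or.inl (Or.inl ((ih _ _ _).2.2.2 hdt))
      · exact Or.inl (Or.inr ((ih _ _ _).2.2.1 hdt))

theorem exists_leaves_of_wellShaped {s : HalfTile} (hs : s.IsWellShaped) (m : ℕ) :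
    ∃ (n : ℕ) (r : Bool) (u v w : Plane), 1 ≤ n ∧ Shape r u v w ∧
      s.descendants m ⊆ leaves n r u v w := by
  obtain ⟨k, a, b, c⟩ := s
  have h := descendants_subset_leaves m a b c
  cases k
  · obtain ⟨h1, h2, h3⟩ := hs
    refine ⟨2 * m + 2, true, b, c, a, by omega, ⟨?_, ?_, ?_⟩, h.1⟩
    · rwa [dist_comm]
    · rw [h3, dist_comm a c]
    · rw [h2, dist_comm a c]
  · obtain ⟨h1, h2, h3⟩ := hs
    refine ⟨2 * m + 1, false, c, a, b, by omega, ⟨?_, ?_, ?_⟩, h.2.1⟩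
    · rwa [dist_comm, h2]
    · rw [dist_comm a b, dist_comm c b, h2]
    · rw [dist_comm c a, dist_comm c b, h2, h3]
  · obtain ⟨h1, h2, h3⟩ := hs
    exact ⟨2 * m + 1, true, a, b, c, by omega, ⟨h1, h2, h3⟩, h.2.2.1⟩
  · obtain ⟨h1, h2, h3⟩ := hs
    refine ⟨2 * m + 2, false, b, c, a, by omega, ⟨?_, ?_, ?_⟩, h.2.2.2⟩
    · rwa [dist_comm]
    · rw [dist_comm c a, dist_comm b a, h2]
    · rw [dist_comm b a, h3]

/-- Induction over the half tiles of a golden triangle, by the side of the cut they are on. -/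
theorem leaves_induction {P : ℕ → Bool → Plane → Plane → Plane → HalfTile → Prop}
    (base : ∀ n r u v w t, 1 ≤ n → n < 3 → Shape r u v w → t ∈ leaves n r u v w → P n r u v w t)
    (tt_left : ∀ n u v w t, Shape true u v w → t ∈ leaves (n + 2) false w u (HalfTile.cut u v) →
      P (n + 2) false w u (HalfTile.cut u v) t → P (n + 3) true u v w t)
    (tt_right : ∀ n u v w t, Shape true u v w → t ∈ leaves (n + 1) true w (HalfTile.cut u v) v →
      P (n + 1) true w (HalfTile.cut u v) v t → P (n + 3) true u v w t)
    (ff_left : ∀ n u v w t, Shape false u v w → t ∈ leaves (n + 2) true u w (HalfTile.cut u v) →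
      P (n + 2) true u w (HalfTile.cut u v) t → P (n + 3) false u v w t)
    (ff_right : ∀ n u v w t, Shape false u v w → t ∈ leaves (n + 1) false v w (HalfTile.cut u v) →
      P (n + 1) false v w (HalfTile.cut u v) t → P (n + 3) false u v w t)
    (n : ℕ) : ∀ (r : Bool) (u v w : Plane) (t : HalfTile), Shape r u v w → t ∈ leaves n r u v w →
      P n r u v w t := by
  induction n using Nat.strong_induction_on with
  | _ n ih =>
    intro r u v w t hS ht
    match n, r with
    | 0, _ => simp [leaves] at ht
    | 1, r => exact base 1 r u v w t le_rfl (by omega) hS ht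
    | 2, r => exact base 2 r u v w t (by omega) (by omega) hS ht
    | n + 3, true =>
      rw [leaves] at ht
      rcases ht with ht | ht
      · exact tt_left n u v w t hS ht (ih _ (by omega) _ _ _ _ t hS.true_cut.1 ht)
      · exact tt_right n u v w t hS ht (ih _ (by omega) _ _ _ _ t hS.true_cut.2 ht)
    | n + 3, false =>
      rw [leaves] at ht
      rcases ht with ht | ht
      · exact ff_left n u v w t hS ht (ih _ (by omega) _ _ _ _ t hS.false_cut.1 ht)
      · exact ff_right n u v w t hS ht (ih _ (by omega) _ _ _ _ t hS.false_cut.2 ht)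

/-! ### Areas, shapes and disjointness of the half tiles of a triangle -/

/-- Twice the signed area of a half tile. -/
def HalfTile.sarea (t : HalfTile) : ℝ := ar t.a t.b t.c

theorem sarea_base {n : ℕ} {r : Bool} {u v w : Plane} {t : HalfTile} (h1 : 1 ≤ n) (h2 : n < 3)
    (ht : t ∈ leaves n r u v w) : t.sarea = ar u v w := by
  interval_cases n <;> cases r <;> simp only [leaves, Set.mem_singleton_iff] at ht <;> subst ht
  · exact ar_rotate u v w
  · rfl
  · exact ar_rotate' u v w
  · exact ar_rotate' u v w

/-- Within one dissection area is proportional to `φ` to the power of the level: the parts have the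
fractions `φ⁻¹` and `φ⁻²` of the area and levels lower by 1 and 2. The exponent `k` is the level of
the half tile itself. -/
theorem leaves_area {n : ℕ} {r : Bool} {u v w : Plane} {t : HalfTile} (hS : Shape r u v w)
    (ht : t ∈ leaves n r u v w) :
    ∃ k, 1 ≤ k ∧ k < 3 ∧ |t.sarea| * φ ^ n = |ar u v w| * φ ^ k := by
  have hφ := Real.goldenRatio_pos
  have hL : ∀ n k : ℕ, ∀ A B : ℝ, A * φ ^ (n + 2) = φ⁻¹ * B * φ ^ k →
      A * φ ^ (n + 3) = B * φ ^ k := by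
    intro n k A B h
    rw [pow_succ, ← mul_assoc, h]
    field_simp
  have hR : ∀ n k : ℕ, ∀ A B : ℝ, A * φ ^ (n + 1) = (1 - φ⁻¹) * B * φ ^ k →
      A * φ ^ (n + 3) = B * φ ^ k := by
    intro n k A B h
    rw [← inv_golden_sq] at h
    rw [show n + 3 = n + 1 + 2 by ring, pow_add, ← mul_assoc, h]
    field_simp
  refine leaves_induction (P := fun n r u v w t =>
    ∃ k, 1 ≤ k ∧ k < 3 ∧ |t.sarea| * φ ^ n = |ar u v w| * φ ^ k) ?_ ?_ ?_ ?_ ?_ n r u v w t hS ht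
  · intro n r u v w t h1 h2 _ ht
    exact ⟨n, h1, h2, by rw [sarea_base h1 h2 ht]⟩
  · rintro n u v w t _ _ ⟨k, h1, h2, h⟩
    rw [ar_rotate' u _ w, abs_ar_cut_left] at h
    exact ⟨k, h1, h2, hL _ _ _ _ h⟩
  · rintro n u v w t _ _ ⟨k, h1, h2, h⟩
    rw [ar_rotate' _ v w, abs_ar_cut_right] at h
    exact ⟨k, h1, h2, hR _ _ _ _ h⟩
  · rintro n u v w t _ _ ⟨k, h1, h2, h⟩
    rw [ar_swap u _ w, abs_neg, abs_ar_cut_left] at h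
    exact ⟨k, h1, h2, hL _ _ _ _ h⟩
  · rintro n u v w t _ _ ⟨k, h1, h2, h⟩
    rw [ar_rotate _ v w, abs_ar_cut_right] at h
    exact ⟨k, h1, h2, hR _ _ _ _ h⟩

theorem leaves_sarea_ne_zero {n : ℕ} {r : Bool} {u v w : Plane} {t : HalfTile}
    (hS : Shape r u v w) (ht : t ∈ leaves n r u v w) : t.sarea ≠ 0 := by
  obtain ⟨k, _, _, h⟩ := leaves_area hS ht
  intro h0
  rw [h0, abs_zero, zero_mul, eq_comm, mul_eq_zero] at h
  have := Real.goldenRatio_pos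
  rcases h with h | h
  · exact hS.ar_ne_zero (abs_eq_zero.1 h)
  · exact (by positivity : φ ^ k ≠ 0) h

theorem leaves_wellShaped {n : ℕ} {r : Bool} {u v w : Plane} {t : HalfTile} (hS : Shape r u v w)
    (ht : t ∈ leaves n r u v w) : t.IsWellShaped := by
  refine leaves_induction (P := fun n r u v w t => t.IsWellShaped) ?_ ?_ ?_ ?_ ?_ n r u v w t hS ht
  · intro n r u v w t h1 h2 hS ht
    interval_cases n <;> cases r <;> simp only [leaves, Set.mem_singleton_iff] at ht <;>
      subst ht <;> obtain ⟨h1, h2, h3⟩ := hS <;> simp only [HalfTile.IsWellShaped]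
    · rw [dist_comm w v, dist_comm w u, dist_comm v u, h2, h3]
      exact ⟨h1, rfl, rfl⟩
    · exact ⟨h1, h2, h3⟩
    · rw [dist_comm w v, dist_comm w u]
      exact ⟨h1, h2, h3⟩
    · rw [dist_comm w v]
      exact ⟨h1, h3, h2⟩
  all_goals intros; assumption

/-- A common point lies on the cut, where the coordinate at `u` in the left part vanishes; in the
interior of that part it is positive. -/
theorem disjoint_interior_cut {u v w : Plane} (h : ar u v w ≠ 0) :
    Disjoint (interior (tri u (HalfTile.cut u v) w)) (interior (tri (HalfTile.cut u v) v w)) := by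
  obtain ⟨k0, k1⟩ := inv_golden_bounds
  have hX : ar u (HalfTile.cut u v) w ≠ 0 := by
    rw [HalfTile.cut, ar_lineMap_left]; exact mul_ne_zero (by linarith) h
  rw [Set.disjoint_left]
  intro x hx1 hx2
  have hpos := bary_pos_of_mem_interior hX (fun y hy => ((mem_tri_iff hX).1 hy).1) hx1
  obtain ⟨s, hs, rfl⟩ := exists_lineMap_of_mem_inter h (by linarith) (by linarith)
    (interior_subset hx1) (interior_subset hx2)
  have : bary u (HalfTile.cut u v) w (AffineMap.lineMap w (HalfTile.cut u v) s) = 0 := by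
    rw [bary, div_eq_zero_iff]; left
    simp only [ar_eq, lineMap_coord]; ring
  rw [HalfTile.cut] at this hpos
  linarith

theorem leaves_cut_disjoint {u v w : Plane} (h : ar u v w ≠ 0) {t t' : HalfTile}
    (ht : t.region ⊆ tri u (HalfTile.cut u v) w) (ht' : t'.region ⊆ tri (HalfTile.cut u v) v w) :
    Disjoint (interior t.region) (interior t'.region) :=
  (disjoint_interior_cut h).mono (interior_mono ht) (interior_mono ht')

theorem ne_of_disjoint_interior {t t' : HalfTile} (h : t.sarea ≠ 0)
    (hd : Disjoint (interior t.region) (interior t'.region)) : t ≠ t' := by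
  rintro rfl
  obtain ⟨x, hx⟩ := interior_tri_nonempty h
  exact Set.disjoint_left.1 hd hx hx

section sides

variable {n : ℕ} {u v w : Plane} {t : HalfTile}

theorem region_tt_left (ht : t ∈ leaves n false w u (HalfTile.cut u v)) :
    t.region ⊆ tri u (HalfTile.cut u v) w :=
  (leaves_region_subset _ _ _ _ _ t ht).trans (tri_rotate' u _ w).subset

theorem region_tt_right (ht : t ∈ leaves n true w (HalfTile.cut u v) v) :
    t.region ⊆ tri (HalfTile.cut u v) v w :=
  (leaves_region_subset _ _ _ _ _ t ht).trans (tri_rotate' _ v w).subset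

theorem region_ff_left (ht : t ∈ leaves n true u w (HalfTile.cut u v)) :
    t.region ⊆ tri u (HalfTile.cut u v) w :=
  (leaves_region_subset _ _ _ _ _ t ht).trans (tri_swap u _ w).subset

theorem region_ff_right (ht : t ∈ leaves n false v w (HalfTile.cut u v)) :
    t.region ⊆ tri (HalfTile.cut u v) v w :=
  (leaves_region_subset _ _ _ _ _ t ht).trans (tri_rotate _ v w).subset

end sides

theorem leaves_disjoint {n : ℕ} {r : Bool} {u v w : Plane} {t : HalfTile} (hS : Shape r u v w)
    (ht : t ∈ leaves n r u v w) : ∀ t' ∈ leaves n r u v w, t ≠ t' →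
      Disjoint (interior t.region) (interior t'.region) := by
  refine leaves_induction (P := fun n r u v w t => ∀ t' ∈ leaves n r u v w, t ≠ t' →
      Disjoint (interior t.region) (interior t'.region)) ?_ ?_ ?_ ?_ ?_ n r u v w t hS ht
  · intro n r u v w t h1 h2 _ ht t' ht' hne
    refine absurd ?_ hne
    interval_cases n <;> cases r <;> simp only [leaves, Set.mem_singleton_iff] at ht ht' <;>
      rw [ht, ht']
  · intro n u v w t hS ht ih t' ht' hne
    rw [leaves] at ht'
    rcases ht' with ht' | ht'
    · exact ih t' ht' hne
    · exact leaves_cut_disjoint hS.ar_ne_zero (region_tt_left ht) (region_tt_right ht')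
  · intro n u v w t hS ht ih t' ht' hne
    rw [leaves] at ht'
    rcases ht' with ht' | ht'
    · exact (leaves_cut_disjoint hS.ar_ne_zero (region_tt_left ht') (region_tt_right ht)).symm
    · exact ih t' ht' hne
  · intro n u v w t hS ht ih t' ht' hne
    rw [leaves] at ht'
    rcases ht' with ht' | ht'
    · exact ih t' ht' hne
    · exact leaves_cut_disjoint hS.ar_ne_zero (region_ff_left ht) (region_ff_right ht')
  · intro n u v w t hS ht ih t' ht' hne
    rw [leaves] at ht'
    rcases ht' with ht' | ht'
    · exact (leaves_cut_disjoint hS.ar_ne_zero (region_ff_left ht') (region_ff_right ht)).symm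
    · exact ih t' ht' hne

/-! ### Finding the other half of a tile -/

/-- `Axis r j p q k b c`: the subdivision of a side `[p, q]` of type `r` and index `j` contains the
axis `[b, c]` of a half tile of kind `k`. -/
inductive Axis : Bool → ℕ → Plane → Plane → Kind → Plane → Plane → Prop
  | kite (p q : Plane) : Axis true 4 p q .halfKite p q
  | dart (p q : Plane) : Axis true 2 p q .halfDart q p
  | thick (p q : Plane) : Axis false 4 p q .halfThick p q
  | thin (p q : Plane) : Axis false 0 p q .halfThin p q
  | tt_left {j : ℕ} {u v : Plane} {k : Kind} {b c : Plane} :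
      Axis false (j + 2) u (HalfTile.cut u v) k b c → Axis true (j + 5) u v k b c
  | tt_right {j : ℕ} {u v : Plane} {k : Kind} {b c : Plane} :
      Axis false j (HalfTile.cut u v) v k b c → Axis true (j + 5) u v k b c
  | ff_left {j : ℕ} {u v : Plane} {k : Kind} {b c : Plane} :
      Axis false (j + 3) (HalfTile.cut u v) u k b c → Axis false (j + 5) u v k b c
  | ff_right {j : ℕ} {u v : Plane} {k : Kind} {b c : Plane} :
      Axis true (j + 2) v (HalfTile.cut u v) k b c → Axis false (j + 5) u v k b c

theorem cut_mem_segment (u v : Plane) : HalfTile.cut u v ∈ segment ℝ u v := by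
  rw [segment_eq_image_lineMap]
  exact ⟨_, ⟨by linarith [inv_golden_bounds.1], by linarith [inv_golden_bounds.2]⟩, rfl⟩

theorem Axis.mem_segment {r : Bool} {j : ℕ} {p q : Plane} {k : Kind} {b c : Plane}
    (h : Axis r j p q k b c) : b ∈ segment ℝ p q := by
  have sub : ∀ {x y p q : Plane}, x ∈ segment ℝ p q → y ∈ segment ℝ p q →
    segment ℝ x y ⊆ segment ℝ p q := fun hx hy => (convex_segment _ _).segment_subset hx hy
  induction h with
  | kite p q => exact left_mem_segment ℝ p q
  | dart p q => exact right_mem_segment ℝ p q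
  | thick p q => exact left_mem_segment ℝ p q
  | thin p q => exact left_mem_segment ℝ p q
  | tt_left _ ih => exact sub (left_mem_segment _ _ _) (cut_mem_segment _ _) ih
  | tt_right _ ih => exact sub (cut_mem_segment _ _) (right_mem_segment _ _ _) ih
  | ff_left _ ih => exact sub (cut_mem_segment _ _) (left_mem_segment _ _ _) ih
  | ff_right _ ih => exact sub (right_mem_segment _ _ _) (cut_mem_segment _ _) ih

/-- The axis `[b, c]` of a half tile of kind `k` lies on a side of the golden triangle. -/
def SideAxis (n : ℕ) : Bool → Plane → Plane → Plane → Kind → Plane → Plane → Prop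
  | true, u, v, w, k, b, c => Axis true (n + 2) u v k b c ∨ Axis false (n + 1) w u k b c ∨
      Axis false (n - 1) v w k b c
  | false, u, v, w, k, b, c => Axis false (n + 2) u v k b c ∨ Axis true (n + 1) u w k b c ∨
      Axis false n v w k b c

/-- The recursive constructors of `Axis` follow a cut side into the part that contains the axis, in
step with `leaves`; an uncut side is already a side of one part. The base constructors are the axes
of the single half tiles of levels 1 and 2. -/
theorem SideAxis.exists_leaf {k : Kind} {b c : Plane} (n : ℕ) : ∀ (r : Bool) (u v w : Plane),
    1 ≤ n → SideAxis n r u v w k b c →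
      ∃ t ∈ leaves n r u v w, t.kind = k ∧ t.b = b ∧ t.c = c := by
  induction n using Nat.strong_induction_on with
  | _ n ih =>
    intro r u v w hn h
    match n, r with
    | 0, _ => omega
    | 1, true =>
      rcases h with h | h | h <;> cases h
      exact ⟨_, rfl, rfl, rfl, rfl⟩
    | 1, false =>
      rcases h with h | h | h <;> cases h
      exact ⟨_, rfl, rfl, rfl, rfl⟩
    | 2, true =>
      rcases h with h | h | h <;> cases h
      exact ⟨_, rfl, rfl, rfl, rfl⟩
    | 2, false =>
      rcases h with h | h | h <;> cases h
      exact ⟨_, rfl, rfl, rfl, rfl⟩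
    | n + 3, true =>
      have L := ih (n + 2) (by omega) false w u (HalfTile.cut u v) (by omega)
      have R := ih (n + 1) (by omega) true w (HalfTile.cut u v) v (by omega)
      rw [leaves]
      rcases h with h | h | h
      · cases h with
        | tt_left h => obtain ⟨t, ht, e⟩ := L (Or.inr (Or.inr h)); exact ⟨t, Or.inl ht, e⟩
        | tt_right h => obtain ⟨t, ht, e⟩ := R (Or.inr (Or.inr h)); exact ⟨t, Or.inr ht, e⟩
      · obtain ⟨t, ht, e⟩ := L (Or.inl h); exact ⟨t, Or.inl ht, e⟩
      · obtain ⟨t, ht, e⟩ := R (Or.inr (Or.inl h)); exact ⟨t, Or.inr ht, e⟩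
    | n + 3, false =>
      have L := ih (n + 2) (by omega) true u w (HalfTile.cut u v) (by omega)
      have R := ih (n + 1) (by omega) false v w (HalfTile.cut u v) (by omega)
      rw [leaves]
      rcases h with h | h | h
      · cases h with
        | ff_left h => obtain ⟨t, ht, e⟩ := L (Or.inr (Or.inl h)); exact ⟨t, Or.inl ht, e⟩
        | ff_right h => obtain ⟨t, ht, e⟩ := R (Or.inr (Or.inl h)); exact ⟨t, Or.inr ht, e⟩
      · obtain ⟨t, ht, e⟩ := L (Or.inl h); exact ⟨t, Or.inl ht, e⟩
      · obtain ⟨t, ht, e⟩ := R (Or.inl h); exact ⟨t, Or.inr ht, e⟩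

/-- The axis of a half tile lies on the boundary, or the other half of the tile is there, too. -/
theorem sideAxis_or_exists_partner {n : ℕ} {r : Bool} {u v w : Plane} {t : HalfTile}
    (hS : Shape r u v w) (ht : t ∈ leaves n r u v w) :
    SideAxis n r u v w t.kind t.b t.c ∨
      ∃ t' ∈ leaves n r u v w, t ≠ t' ∧ t'.kind = t.kind ∧ t'.b = t.b ∧ t'.c = t.c := by
  refine leaves_induction (P := fun n r u v w t => SideAxis n r u v w t.kind t.b t.c ∨
      ∃ t' ∈ leaves n r u v w, t ≠ t' ∧ t'.kind = t.kind ∧ t'.b = t.b ∧ t'.c = t.c)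
      ?_ ?_ ?_ ?_ ?_ n r u v w t hS ht
  · intro n r u v w t h1 h2 _ ht
    left
    interval_cases n <;> cases r <;> simp only [leaves, Set.mem_singleton_iff] at ht <;> subst ht
    · exact Or.inr (Or.inl (.dart _ _))
    · exact Or.inr (Or.inr (.thin _ _))
    · exact Or.inl (.thick _ _)
    · exact Or.inl (.kite _ _)
  · intro n u v w t hS ht ih
    rw [leaves]
    rcases ih with (h | h | h) | ⟨t', ht', h⟩
    · exact Or.inl (Or.inr (Or.inl h))
    -- The axis lies on the cut, which is also a side of the other part with the same type and
    -- index. So the other part has a half tile with this axis.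
    · obtain ⟨t', ht', e⟩ := SideAxis.exists_leaf (n + 1) true w (HalfTile.cut u v) v (by omega)
        (Or.inl h)
      exact Or.inr ⟨t', Or.inr ht', ne_of_disjoint_interior (leaves_sarea_ne_zero hS.true_cut.1 ht)
        (leaves_cut_disjoint hS.ar_ne_zero (region_tt_left ht) (region_tt_right ht')), e⟩
    · exact Or.inl (Or.inl (.tt_left h))
    · exact Or.inr ⟨t', Or.inl ht', h⟩
  · intro n u v w t hS ht ih
    rw [leaves]
    rcases ih with (h | h | h) | ⟨t', ht', h⟩
    · obtain ⟨t', ht', e⟩ := SideAxis.exists_leaf (n + 2) false w u (HalfTile.cut u v) (by omega)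
        (Or.inr (Or.inl h))
      exact Or.inr ⟨t', Or.inl ht', ne_of_disjoint_interior (leaves_sarea_ne_zero hS.true_cut.2 ht)
        (leaves_cut_disjoint hS.ar_ne_zero (region_tt_left ht') (region_tt_right ht)).symm, e⟩
    · exact Or.inl (Or.inr (Or.inr h))
    · exact Or.inl (Or.inl (.tt_right h))
    · exact Or.inr ⟨t', Or.inr ht', h⟩
  · intro n u v w t hS ht ih
    rw [leaves]
    rcases ih with (h | h | h) | ⟨t', ht', h⟩
    · exact Or.inl (Or.inr (Or.inl h))
    · exact Or.inl (Or.inl (.ff_left h))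
    · obtain ⟨t', ht', e⟩ := SideAxis.exists_leaf (n + 1) false v w (HalfTile.cut u v) (by omega)
        (Or.inr (Or.inr h))
      exact Or.inr ⟨t', Or.inr ht', ne_of_disjoint_interior (leaves_sarea_ne_zero hS.false_cut.1 ht)
        (leaves_cut_disjoint hS.ar_ne_zero (region_ff_left ht) (region_ff_right ht')), e⟩
    · exact Or.inr ⟨t', Or.inl ht', h⟩
  · intro n u v w t hS ht ih
    rw [leaves]
    rcases ih with (h | h | h) | ⟨t', ht', h⟩
    · exact Or.inl (Or.inr (Or.inr h))
    · exact Or.inl (Or.inl (.ff_right h))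
    · obtain ⟨t', ht', e⟩ := SideAxis.exists_leaf (n + 2) true u w (HalfTile.cut u v) (by omega)
        (Or.inr (Or.inr h))
      exact Or.inr ⟨t', Or.inl ht', ne_of_disjoint_interior (leaves_sarea_ne_zero hS.false_cut.2 ht)
        (leaves_cut_disjoint hS.ar_ne_zero (region_ff_left ht') (region_ff_right ht)).symm, e⟩
    · exact Or.inr ⟨t', Or.inr ht', h⟩

theorem notMem_interior_of_mem_segment {u v w x : Plane} (h : ar u v w ≠ 0)
    (hx : x ∈ segment ℝ u v) : x ∉ interior (tri u v w) := by
  intro hi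
  have h' : ar w u v ≠ 0 := by rwa [ar_rotate']
  have := bary_pos_of_mem_interior h' (fun y hy => ((mem_tri_iff h).1 hy).2.2) hi
  rw [segment_eq_image_lineMap] at hx
  obtain ⟨s, _, rfl⟩ := hx
  have h0 : bary w u v (AffineMap.lineMap u v s) = 0 := by
    rw [bary, div_eq_zero_iff]; left
    simp only [ar_eq, lineMap_coord]; ring
  linarith

theorem notMem_interior_of_mem_sides {u v w x : Plane} (h : ar u v w ≠ 0)
    (hx : x ∈ segment ℝ u v ∨ x ∈ segment ℝ w u ∨ x ∈ segment ℝ v w) :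
    x ∉ interior (tri u v w) := by
  rcases hx with hx | hx | hx
  · exact notMem_interior_of_mem_segment h hx
  · rw [← tri_rotate']; exact notMem_interior_of_mem_segment (by rwa [ar_rotate']) hx
  · rw [← tri_rotate]; exact notMem_interior_of_mem_segment (by rwa [ar_rotate]) hx

/-- Away from the boundary, the other half of each tile is present. -/
theorem exists_partner {n : ℕ} {r : Bool} {u v w : Plane} {t : HalfTile}
    (hS : Shape r u v w) (ht : t ∈ leaves n r u v w) (hb : t.b ∈ interior (tri u v w)) :
    ∃ t' ∈ leaves n r u v w, t ≠ t' ∧ t'.kind = t.kind ∧ t'.b = t.b ∧ t'.c = t.c := by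
  refine (sideAxis_or_exists_partner hS ht).resolve_left fun h => ?_
  refine notMem_interior_of_mem_sides hS.ar_ne_zero ?_ hb
  cases r
  · rcases h with h | h | h
    · exact Or.inl h.mem_segment
    · exact Or.inr (Or.inl (by rw [segment_symm]; exact h.mem_segment))
    · exact Or.inr (Or.inr h.mem_segment)
  · rcases h with h | h | h
    · exact Or.inl h.mem_segment
    · exact Or.inr (Or.inl h.mem_segment)
    · exact Or.inr (Or.inr h.mem_segment)

/-! ### Discs inside the image of a triangle -/

/-- The union of the sides of a triangle. -/
def triSides (u v w : Plane) : Set Plane := segment ℝ u v ∪ segment ℝ w u ∪ segment ℝ v w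

theorem mem_segment_of_bary_eq_zero {u v w x : Plane} (h : ar u v w ≠ 0) (hx : x ∈ tri u v w)
    (h0 : bary w u v x = 0) : x ∈ segment ℝ u v := by
  have hb := (mem_tri_iff h).1 hx
  refine ⟨_, _, hb.1, hb.2.1, ?_, ?_⟩
  · have := bary_add h x; rw [h0] at this; linarith
  · conv_rhs => rw [eq_bary_comb h x, h0]
    simp

theorem mem_sides_of_bary {u v w x : Plane} (h : ar u v w ≠ 0)
    (h0 : min (bary u v w x) (min (bary v w u x) (bary w u v x)) = 0) :
    x ∈ triSides u v w ∧ x ∈ tri u v w := by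
  have hx : x ∈ tri u v w := (mem_tri_iff h).2
    ⟨h0 ▸ min_le_left _ _, h0 ▸ (min_le_right _ _).trans (min_le_left _ _),
      h0 ▸ (min_le_right _ _).trans (min_le_right _ _)⟩
  refine ⟨?_, hx⟩
  rcases min_choice (bary u v w x) (min (bary v w u x) (bary w u v x)) with e | e <;> rw [e] at h0
  · exact Or.inr (mem_segment_of_bary_eq_zero (by rwa [ar_rotate]) (by rwa [tri_rotate]) h0)
  · rcases min_choice (bary v w u x) (bary w u v x) with e | e <;> rw [e] at h0
    · exact Or.inl (Or.inr
        (mem_segment_of_bary_eq_zero (by rwa [ar_rotate']) (by rwa [tri_rotate']) h0))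
    · exact Or.inl (Or.inl (mem_segment_of_bary_eq_zero h hx h0))

/-- A path from the triangle to the outside meets a side. -/
theorem exists_mem_sides {u v w x z : Plane} (h : ar u v w ≠ 0) (hx : x ∈ tri u v w)
    (hz : z ∉ tri u v w) :
    ∃ θ ∈ Set.Icc (0 : ℝ) 1, AffineMap.lineMap x z θ ∈ triSides u v w ∧
      AffineMap.lineMap x z θ ∈ tri u v w := by
  -- The least barycentric coordinate is nonnegative on the triangle and negative outside, and its
  -- zeros lie on the sides.
  let m : Plane → ℝ := fun x => min (bary u v w x) (min (bary v w u x) (bary w u v x))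
  have hm : Continuous m := (continuous_bary _ _ _).min
    ((continuous_bary _ _ _).min (continuous_bary _ _ _))
  have hg : Continuous fun θ : ℝ => m (AffineMap.lineMap x z θ) :=
    hm.comp AffineMap.lineMap_continuous
  obtain ⟨θ, hθ, h0⟩ := intermediate_value_Icc' (a := (0:ℝ)) (b := 1) (δ := ℝ) zero_le_one
    hg.continuousOn (show (0:ℝ) ∈ _ by
      have hb := (mem_tri_iff h).1 hx
      constructor
      · by_contra hneg
        rw [AffineMap.lineMap_apply_one, not_le, lt_min_iff, lt_min_iff] at hneg
        exact hz ((mem_tri_iff h).2 ⟨hneg.1.le, hneg.2.1.le, hneg.2.2.le⟩)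
      · rw [AffineMap.lineMap_apply_zero]
        exact le_min hb.1 (le_min hb.2.1 hb.2.2))
  exact ⟨θ, hθ, mem_sides_of_bary h h0⟩

theorem SelfMap.inv_mem_segment {T : Set Plane} {L : ℝ} {F G : Plane → Plane}
    (h : SelfMap T L F G) {p q : Plane} (hp : p ∈ T) (hq : q ∈ T) (hT : Convex ℝ T) {e : ℝ → ℝ}
    (he : Reparam e) (ha : ActsOn F p q e) {x : Plane} (hx : x ∈ segment ℝ p q) :
    G x ∈ segment ℝ p q := by
  rw [segment_eq_image_lineMap] at hx ⊢
  obtain ⟨s, hs, rfl⟩ := hx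
  obtain ⟨r, hr, _, e⟩ := h.actsOn_inv hp hq hT he ha hs
  exact ⟨r, hr, e.symm⟩

/-- That the inverse preserves the boundary is read off from the action on the sides, so no
invariance of domain is required for `IsEqualizer.ball_subset`. -/
theorem IsEqualizer.inv_mem_sides {n : ℕ} {r : Bool} {u v w : Plane} {F G : Plane → Plane}
    (h : IsEqualizer n r u v w F G) {x : Plane} (hx : x ∈ triSides u v w) : G x ∈ triSides u v w := by
  have hu := left_mem_tri u v w
  have hv := mid_mem_tri u v w
  have hw := right_mem_tri u v w
  have hT := convex_tri u v w
  have hE := reparam_edgeMap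
  have hM := h.selfMap
  cases r
  · obtain ⟨a1, a2, a3⟩ := h.sides
    rcases hx with (hx | hx) | hx
    · exact Or.inl (Or.inl (hM.inv_mem_segment hu hv hT (hE _ _) a1 hx))
    · exact Or.inl (Or.inr (hM.inv_mem_segment hw hu hT (hE _ _).rev a2.rev hx))
    · exact Or.inr (hM.inv_mem_segment hv hw hT (hE _ _) a3 hx)
  · obtain ⟨a1, a2, a3⟩ := h.sides
    rcases hx with (hx | hx) | hx
    · exact Or.inl (Or.inl (hM.inv_mem_segment hu hv hT (hE _ _) a1 hx))
    · exact Or.inl (Or.inr (hM.inv_mem_segment hw hu hT (hE _ _) a2 hx))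
    · exact Or.inr (hM.inv_mem_segment hv hw hT (hE _ _) a3 hx)

/-- If the triangle contains the ball of radius `R` about `x`, then the ball of radius `R / L`
about `F x` belongs to the image, that is, to the triangle. -/
theorem IsEqualizer.ball_subset {n : ℕ} {r : Bool} {u v w : Plane} {F G : Plane → Plane}
    (h : IsEqualizer n r u v w F G) (hne : ar u v w ≠ 0) {x : Plane} {R : ℝ} (hR : 0 < R)
    (hB : Metric.ball x R ⊆ tri u v w) :
    Metric.ball (F x) (R / lipConst n) ⊆ tri u v w := by
  intro z hz
  by_contra hzT
  have hL := lipConst_pos n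
  have hx : x ∈ tri u v w := hB (Metric.mem_ball_self hR)
  -- On the way from `F x` to a point of the disc outside the triangle there is a point of a side.
  -- Its preimage would be a point of a side at distance less than `R` from `x`.
  obtain ⟨θ, hθ, hs, hT⟩ := exists_mem_sides hne (h.selfMap.mapsTo hx) hzT
  have hd : dist (G (AffineMap.lineMap (F x) z θ)) x < R := by
    have h1 := h.selfMap.lip_inv _ hT _ (h.selfMap.mapsTo hx)
    rw [h.selfMap.left_inv x hx] at h1
    refine h1.trans_lt ?_
    rw [dist_comm, dist_left_lineMap, Real.norm_of_nonneg hθ.1, dist_comm]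
    have h2 : dist z (F x) < R / lipConst n := hz
    rw [lt_div_iff₀ hL] at h2
    have h3 : θ * dist z (F x) ≤ dist z (F x) := mul_le_of_le_one_left dist_nonneg hθ.2
    nlinarith
  have hi : G (AffineMap.lineMap (F x) z θ) ∈ interior (tri u v w) :=
    interior_maximal hB Metric.isOpen_ball hd
  refine notMem_interior_of_mem_sides hne ?_ hi
  have := h.inv_mem_sides hs
  simpa [triSides, or_assoc] using this

/-! ### Limits of bi-Lipschitz maps along an ultrafilter -/

open Filter Topology in
/-- The limit, along an ultrafilter, of uniformly bi-Lipschitz maps between sets that exhaust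
the plane. -/
theorem exists_homeomorph_tendsto {ι : Type*} (U : Ultrafilter ι) (S S' : ι → Set Plane)
    (f g : ι → Plane → Plane) (K : NNReal)
    (hS : ∀ x, ∀ᶠ i in U, x ∈ S i) (hS' : ∀ x, ∀ᶠ i in U, x ∈ S' i)
    (hf : ∀ i, Set.MapsTo (f i) (S i) (S' i)) (hg : ∀ i, Set.MapsTo (g i) (S' i) (S i))
    (hgf : ∀ i, ∀ x ∈ S i, g i (f i x) = x) (hfg : ∀ i, ∀ y ∈ S' i, f i (g i y) = y)
    (lf : ∀ i, ∀ x ∈ S i, ∀ y ∈ S i, dist (f i x) (f i y) ≤ K * dist x y)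
    (lg : ∀ i, ∀ x ∈ S' i, ∀ y ∈ S' i, dist (g i x) (g i y) ≤ K * dist x y)
    (f0 : ∀ i, f i 0 = 0) :
    ∃ Φ : Plane ≃ₜ Plane, LipschitzWith K Φ ∧ LipschitzWith K Φ.symm ∧
      ∀ x, Tendsto (fun i => f i x) U (𝓝 (Φ x)) := by
  -- For each `x` the values eventually stay in a compact disc, because 0 is fixed; so they converge
  -- along the ultrafilter, and the Lipschitz bound passes to the limit.
  have key : ∀ (S : ι → Set Plane) (f : ι → Plane → Plane), (∀ x, ∀ᶠ i in U, x ∈ S i) →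
      (∀ i, ∀ x ∈ S i, ∀ y ∈ S i, dist (f i x) (f i y) ≤ K * dist x y) →
      (∀ᶠ i in U, f i 0 = 0) →
      ∃ F : Plane → Plane, LipschitzWith K F ∧ ∀ x, Tendsto (fun i => f i x) U (𝓝 (F x)) := by
    intro S f hS lf f0
    have hlim : ∀ x, ∃ y, Tendsto (fun i => f i x) U (𝓝 y) := by
      intro x
      have hb : ∀ᶠ i in U, f i x ∈ Metric.closedBall (0 : Plane) (K * dist x 0) := by
        filter_upwards [hS x, hS 0, f0] with i h1 h2 h3
        rw [Metric.mem_closedBall]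
        calc dist (f i x) 0 = dist (f i x) (f i 0) := by rw [h3]
          _ ≤ _ := lf i x h1 0 h2
      obtain ⟨y, _, hy⟩ := (isCompact_closedBall (0 : Plane) (K * dist x 0)).ultrafilter_le_nhds'
        (U.map fun i => f i x) hb
      exact ⟨y, hy⟩
    choose F hF using hlim
    refine ⟨F, LipschitzWith.of_dist_le_mul fun x y => ?_, hF⟩
    refine le_of_tendsto ((hF x).dist (hF y)) ?_
    filter_upwards [hS x, hS y] with i h1 h2 using lf i x h1 y h2
  have g0 : ∀ᶠ i in U, g i 0 = 0 := by
    filter_upwards [hS 0] with i hi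
    have := hgf i 0 hi
    rwa [f0] at this
  obtain ⟨F, lF, tF⟩ := key S f hS lf (Eventually.of_forall f0)
  obtain ⟨G, lG, tG⟩ := key S' g hS' lg g0
  -- Pointwise convergence is enough: `g i (F x)` differs from `g i (f i x) = x` by at most `K *
  -- dist (F x) (f i x)`.
  have inv : ∀ (S S' : ι → Set Plane) (f g : ι → Plane → Plane) (F G : Plane → Plane),
      (∀ x, ∀ᶠ i in U, x ∈ S i) → (∀ x, ∀ᶠ i in U, x ∈ S' i) →
      (∀ i, Set.MapsTo (f i) (S i) (S' i)) → (∀ i, ∀ x ∈ S i, g i (f i x) = x) →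
      (∀ i, ∀ x ∈ S' i, ∀ y ∈ S' i, dist (g i x) (g i y) ≤ K * dist x y) →
      (∀ x, Tendsto (fun i => f i x) U (𝓝 (F x))) →
      (∀ x, Tendsto (fun i => g i x) U (𝓝 (G x))) → ∀ x, G (F x) = x := by
    intro S S' f g F G hS hS' hf hgf lg tF tG x
    have h1 : Tendsto (fun i => K * dist (F x) (f i x)) U (𝓝 0) := by
      have := ((tendsto_const_nhds (x := F x)).dist (tF x)).const_mul (K : ℝ)
      simpa using this
    have h2 : Tendsto (fun i => dist (g i (F x)) x) U (𝓝 0) := by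
      refine squeeze_zero' (Eventually.of_forall fun _ => dist_nonneg) ?_ h1
      filter_upwards [hS x, hS' (F x)] with i a b
      calc dist (g i (F x)) x = dist (g i (F x)) (g i (f i x)) := by rw [hgf i x a]
        _ ≤ _ := lg i _ b _ (hf i a)
    exact tendsto_nhds_unique (tG (F x)) (tendsto_iff_dist_tendsto_zero.2 h2)
  have i1 := inv S S' f g F G hS hS' hf hgf lg tF tG
  have i2 := inv S' S g f G F hS' hS hg hfg lf tG tF
  exact ⟨⟨⟨F, G, i1, i2⟩, lF.continuous, lG.continuous⟩, lF, lG, tF⟩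

/-! ### Finite patches and the homeomorphism of the plane -/

theorem abs_coord_le (x : Plane) (i : Fin 2) : |x i| ≤ ‖x‖ := by
  simpa using PiLp.norm_apply_le x i

/-- A convex set that contains the corners of a square contains the inscribed disc. -/
theorem ball_subset_of_corners {T : Set Plane} (hT : Convex ℝ T) {R : ℝ} (hR : 0 < R)
    (h1 : !₂[R, R] ∈ T) (h2 : !₂[-R, R] ∈ T) (h3 : !₂[R, -R] ∈ T) (h4 : !₂[-R, -R] ∈ T) :
    Metric.ball 0 R ⊆ T := by
  intro x hx
  rw [mem_ball_zero_iff] at hx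
  have hi : ∀ i, -R ≤ x i ∧ x i ≤ R := fun i => abs_le.1 ((abs_coord_le x i).trans hx.le)
  have hs : ∀ i, (1 + x i / R) / 2 ∈ Set.Icc (0:ℝ) 1 := by
    intro i
    have e : x i / R ≤ 1 := (div_le_one hR).2 (hi i).2
    have e' : -1 ≤ x i / R := by rw [le_div_iff₀ hR]; linarith [(hi i).1]
    constructor <;> linarith
  have m := hT.lineMap_mem (hT.lineMap_mem h4 h3 (hs 0)) (hT.lineMap_mem h2 h1 (hs 0)) (hs 1)
  convert m using 1
  ext i
  fin_cases i <;> simp [lineMap_coord] <;> field_simp <;> ring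

/-- Both bounds follow from `φ ^ (n + 1) = φ * fib (n + 1) + fib n` and `fib n ≤ fib (n + 1)`. -/
theorem fib_growth (n : ℕ) (hn : 1 ≤ n) :
    (Nat.fib n : ℝ) ≤ φ ^ n ∧ φ ^ n ≤ 3 * (Nat.fib n : ℝ) := by
  obtain ⟨n, rfl⟩ := Nat.exists_eq_add_of_le' hn
  have h := Real.goldenRatio_mul_fib_succ_add_fib n
  have h1 : (Nat.fib n : ℝ) ≤ Nat.fib (n + 1) := by exact_mod_cast Nat.fib_mono (by omega)
  have h0 : (0 : ℝ) ≤ Nat.fib n := by positivity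
  have h2 := fib_pos' n
  constructor <;> nlinarith [Real.one_lt_goldenRatio, Real.goldenRatio_lt_two]

/-- The area to which the half tiles are equalized is comparable to the area of any one of them,
independently of the level. This bounds the scaling factors in the passage to the limit. -/
theorem leaf_mass_bounds {n : ℕ} {r : Bool} {u v w : Plane} {t : HalfTile} (hn : 1 ≤ n)
    (hS : Shape r u v w) (ht : t ∈ leaves n r u v w) :
    |t.sarea| / 4 ≤ |ar u v w| / Nat.fib n ∧ |ar u v w| / Nat.fib n ≤ 3 * |t.sarea| := by
  obtain ⟨k, k1, k2, h⟩ := leaves_area hS ht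
  obtain ⟨g1, g2⟩ := fib_growth n hn
  obtain ⟨j, rfl⟩ := Nat.exists_eq_add_of_le' hn
  have hf := fib_pos' j
  have hk : 1 ≤ φ ^ k ∧ φ ^ k ≤ 4 := by
    have := Real.one_lt_goldenRatio
    have := Real.goldenRatio_lt_two
    interval_cases k <;> constructor <;> nlinarith
  have ha := abs_nonneg t.sarea
  have hb := abs_nonneg (ar u v w)
  rw [le_div_iff₀ hf, div_le_iff₀ hf]
  constructor
  · nlinarith [mul_le_mul_of_nonneg_left g1 ha, mul_le_mul_of_nonneg_left hk.2 hb]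
  · nlinarith [mul_le_mul_of_nonneg_left g2 ha, mul_le_mul_of_nonneg_left hk.1 hb]

theorem AffineOn.smul_sub {F : Plane → Plane} {a b c : Plane} (h : AffineOn F a b c) (μ : ℝ)
    (p : Plane) : AffineOn (fun x => μ • (F x - p)) a b c := by
  intro α β γ hα hβ hγ hs
  simp only
  rw [h α β γ hα hβ hγ hs]
  have e : μ • p = α • (μ • p) + β • (μ • p) + γ • (μ • p) := by
    rw [← add_smul, ← add_smul, hs, one_smul]
  rw [_root_.smul_sub, e]
  module

theorem ar_smul_sub (μ : ℝ) (p a b c : Plane) :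
    ar (μ • (a - p)) (μ • (b - p)) (μ • (c - p)) = μ ^ 2 * ar a b c := by
  simp only [ar_eq, PiLp.smul_apply, PiLp.sub_apply, smul_eq_mul]; ring

theorem continuous_ar : Continuous fun q : Plane × Plane × Plane => ar q.1 q.2.1 q.2.2 := by
  simp only [ar_eq]
  fun_prop

theorem IsHalfTileTiling.exists_mem {σ : Set HalfTile} (hσ : IsHalfTileTiling σ) (x : Plane) :
    ∃ t ∈ σ, x ∈ t.region := by
  have : x ∈ ⋃ t ∈ σ, t.region := by rw [hσ.cover]; trivial
  simpa using this

/-- Finitely many half tiles belong to the dissection of one golden triangle. -/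
theorem IsHalfTileTiling.exists_patch {σ : Set HalfTile} (hσ : IsHalfTileTiling σ)
    (P : Finset σ) : ∃ (n : ℕ) (r : Bool) (u v w : Plane), 1 ≤ n ∧ Shape r u v w ∧
      ∀ t ∈ P, (t : HalfTile) ∈ leaves n r u v w := by
  obtain ⟨s, m, hs, hP⟩ := hσ.patch (Subtype.val '' (P : Set σ))
    (by rintro _ ⟨t, _, rfl⟩; exact t.2) ((Finset.finite_toSet P).image _)
  obtain ⟨n, r, u, v, w, hn, hS, hsub⟩ := exists_leaves_of_wellShaped hs m
  exact ⟨n, r, u, v, w, hn, hS, fun t ht => hsub (hP ⟨t, ht, rfl⟩)⟩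

/-- A finite set of half tiles such that each golden triangle whose dissection contains them
contains a given disc. -/
theorem IsHalfTileTiling.exists_spanning {σ : Set HalfTile} (hσ : IsHalfTileTiling σ)
    {R : ℝ} (hR : 0 < R) : ∃ P : Finset σ, ∀ (n : ℕ) (r : Bool) (u v w : Plane),
      (∀ t ∈ P, (t : HalfTile) ∈ leaves n r u v w) → Metric.ball 0 R ⊆ tri u v w := by
  classical
  obtain ⟨t₁, h₁, m₁⟩ := hσ.exists_mem !₂[R, R]
  obtain ⟨t₂, h₂, m₂⟩ := hσ.exists_mem !₂[-R, R]
  obtain ⟨t₃, h₃, m₃⟩ := hσ.exists_mem !₂[R, -R]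
  obtain ⟨t₄, h₄, m₄⟩ := hσ.exists_mem !₂[-R, -R]
  refine ⟨{⟨t₁, h₁⟩, ⟨t₂, h₂⟩, ⟨t₃, h₃⟩, ⟨t₄, h₄⟩}, fun n r u v w h => ?_⟩
  exact ball_subset_of_corners (convex_tri u v w) hR
    (leaves_region_subset _ _ _ _ _ _ (h ⟨t₁, h₁⟩ (by simp)) m₁)
    (leaves_region_subset _ _ _ _ _ _ (h ⟨t₂, h₂⟩ (by simp)) m₂)
    (leaves_region_subset _ _ _ _ _ _ (h ⟨t₃, h₃⟩ (by simp)) m₃)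
    (leaves_region_subset _ _ _ _ _ _ (h ⟨t₄, h₄⟩ (by simp)) m₄)

theorem IsHalfTileTiling.wellShaped {σ : Set HalfTile} (hσ : IsHalfTileTiling σ) {t : HalfTile}
    (ht : t ∈ σ) : t.IsWellShaped ∧ t.sarea ≠ 0 := by
  obtain ⟨n, r, u, v, w, _, hS, h⟩ := hσ.exists_patch {⟨t, ht⟩}
  have := h ⟨t, ht⟩ (by simp)
  exact ⟨leaves_wellShaped hS this, leaves_sarea_ne_zero hS this⟩

/-- The bound of all the Lipschitz constants `lipConst n`. -/
def lipBound : ℝ := Real.exp (6 * (1 - φ⁻¹)⁻¹)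

open Filter Topology in
/-- There is a bi-Lipschitz homeomorphism of the plane that maps all half tiles of the tiling
affinely, with orientation preserved, to triangles of one and the same area. -/
theorem IsHalfTileTiling.exists_homeomorph {σ : Set HalfTile} (hσ : IsHalfTileTiling σ) {V : ℝ}
    (hV : 0 < V) : ∃ Φ : Plane ≃ₜ Plane,
      (∃ K : NNReal, LipschitzWith K Φ ∧ LipschitzWith K Φ.symm) ∧
      ∀ t ∈ σ, AffineOn Φ t.a t.b t.c ∧
        ar (Φ t.a) (Φ t.b) (Φ t.c) * (|t.sarea| * V) = t.sarea := by
  classical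
  obtain ⟨t₀, ht₀, -⟩ := hσ.exists_mem 0
  have hA : 0 < |t₀.sarea| := abs_pos.2 (hσ.wellShaped ht₀).2
  set A := |t₀.sarea| with hAdef
  -- A fixed half tile `t₀` is added to every patch, so that the scale of all patches can be
  -- compared with its area `A`.
  have hpatch : ∀ P : Finset σ, ∃ (n : ℕ) (r : Bool) (u v w : Plane) (F G : Plane → Plane),
      1 ≤ n ∧ Shape r u v w ∧ IsEqualizer n r u v w F G ∧
      t₀ ∈ leaves n r u v w ∧ ∀ t ∈ P, (t : HalfTile) ∈ leaves n r u v w := by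
    intro P
    obtain ⟨n, r, u, v, w, hn, hS, h⟩ := hσ.exists_patch (insert ⟨t₀, ht₀⟩ P)
    obtain ⟨F, G, hF⟩ := exists_isEqualizer n r u v w hn hS
    exact ⟨n, r, u, v, w, F, G, hn, hS, hF, h _ (Finset.mem_insert_self _ _),
      fun t ht => h t (Finset.mem_insert_of_mem ht)⟩
  choose n r u v w F G hn hS hF ht₀' hP using hpatch
  -- Twice the common area of the image triangles for the patch `P`.
  let c : Finset σ → ℝ := fun P => |ar (u P) (v P) (w P)| / Nat.fib (n P)
  have hc : ∀ P, A / 4 ≤ c P ∧ c P ≤ 3 * A := fun P => leaf_mass_bounds (hn P) (hS P) (ht₀' P)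
  have hc0 : ∀ P, 0 < c P := fun P => lt_of_lt_of_le (by positivity) (hc P).1
  -- Scaling by `μ P` turns the common value `c P` into `1 / V`.
  let μ : Finset σ → ℝ := fun P => Real.sqrt (1 / (V * c P))
  have hμ0 : ∀ P, 0 < μ P := fun P => Real.sqrt_pos.2 (by have := hc0 P; positivity)
  have hμsq : ∀ P, μ P ^ 2 * (V * c P) = 1 := fun P => by
    have := hc0 P
    rw [Real.sq_sqrt (by positivity)]
    field_simp
  have hμ1 : ∀ P, μ P ≤ Real.sqrt (1 / (V * (A / 4))) := fun P => by
    have := hc0 P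
    have := (hc P).1
    apply Real.sqrt_le_sqrt
    gcongr
  have hμ2 : ∀ P, (μ P)⁻¹ ≤ Real.sqrt (V * (3 * A)) := fun P => by
    have := hc0 P
    have := (hc P).2
    have e : (μ P)⁻¹ = Real.sqrt (V * c P) := by
      simp only [μ]
      rw [← Real.sqrt_inv, one_div, inv_inv]
    rw [e]
    apply Real.sqrt_le_sqrt
    gcongr
  have hL0 : 0 < lipBound := Real.exp_pos _
  let K : NNReal := ⟨lipBound * max (Real.sqrt (1 / (V * (A / 4)))) (Real.sqrt (V * (3 * A))),
    by positivity⟩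
  have hK1 : ∀ P, μ P * lipConst (n P) ≤ K := fun P => by
    rw [mul_comm]
    exact mul_le_mul (lipConst_le _) ((hμ1 P).trans (le_max_left _ _)) (hμ0 P).le hL0.le
  have hK2 : ∀ P, lipConst (n P) * (μ P)⁻¹ ≤ K := fun P =>
    mul_le_mul (lipConst_le _) ((hμ2 P).trans (le_max_right _ _))
      (inv_nonneg.2 (hμ0 P).le) hL0.le
  -- An ultrafilter finer than `atTop`: each half tile of `σ` eventually belongs to the patch.
  let U : Ultrafilter (Finset σ) := Ultrafilter.of atTop
  have hU : (U : Filter (Finset σ)) ≤ atTop := Ultrafilter.of_le atTop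
  have hball : ∀ R : ℝ, 0 < R → ∀ᶠ P in U, Metric.ball 0 R ⊆ tri (u P) (v P) (w P) := by
    intro R hR
    obtain ⟨Q, hQ⟩ := hσ.exists_spanning hR
    filter_upwards [hU (eventually_ge_atTop Q)] with P hPQ
    exact hQ (n P) (r P) _ _ _ fun t ht => hP P t (hPQ ht)
  let f : Finset σ → Plane → Plane := fun P x => μ P • (F P x - F P 0)
  let g : Finset σ → Plane → Plane := fun P y => G P (F P 0 + (μ P)⁻¹ • y)
  let S : Finset σ → Set Plane := fun P => tri (u P) (v P) (w P)
  -- The image of `S P` under the normalized map `f P`, since `F P` maps the triangle onto itself.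
  let S' : Finset σ → Set Plane := fun P => {y | F P 0 + (μ P)⁻¹ • y ∈ tri (u P) (v P) (w P)}
  have hback : ∀ P x, F P 0 + (μ P)⁻¹ • f P x = F P x := fun P x => by
    simp only [f]
    rw [inv_smul_smul₀ (hμ0 P).ne']
    abel
  obtain ⟨Φ, l1, l2, tΦ⟩ := exists_homeomorph_tendsto U S S' f g K
    (fun x => by
      filter_upwards [hball (‖x‖ + 1) (by positivity)] with P h
      exact h (by simp))
    (fun y => by
      -- The radius is such that, divided by the Lipschitz constant, it still exceeds `(μ P)⁻¹ *
      -- ‖y‖`.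
      filter_upwards [hball (K * (‖y‖ + 1) + 1) (by positivity)] with P h
      refine (hF P).ball_subset (hS P).ar_ne_zero (by positivity) h ?_
      rw [Metric.mem_ball, dist_eq_norm, add_sub_cancel_left, norm_smul,
        lt_div_iff₀ (lipConst_pos _), Real.norm_of_nonneg (inv_nonneg.2 (hμ0 P).le)]
      have := hK2 P
      have h0 : 0 ≤ (K : ℝ) := K.2
      calc (μ P)⁻¹ * ‖y‖ * lipConst (n P) = lipConst (n P) * (μ P)⁻¹ * ‖y‖ := by ring
        _ ≤ K * ‖y‖ := by gcongr
        _ < K * (‖y‖ + 1) + 1 := by nlinarith)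
    (fun P x hx => by
      show F P 0 + (μ P)⁻¹ • f P x ∈ tri (u P) (v P) (w P)
      rw [hback]; exact (hF P).selfMap.mapsTo hx)
    (fun P y hy => (hF P).selfMap.mapsTo_inv hy)
    (fun P x hx => by
      show G P (F P 0 + (μ P)⁻¹ • f P x) = x
      rw [hback]; exact (hF P).selfMap.left_inv x hx)
    (fun P y hy => by
      show μ P • (F P (G P (F P 0 + (μ P)⁻¹ • y)) - F P 0) = y
      rw [(hF P).selfMap.right_inv _ hy, add_sub_cancel_left, smul_inv_smul₀ (hμ0 P).ne'])
    (fun P x hx y hy => by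
      show dist (μ P • (F P x - F P 0)) (μ P • (F P y - F P 0)) ≤ _
      rw [dist_smul₀, Real.norm_of_nonneg (hμ0 P).le, dist_sub_right]
      calc μ P * dist (F P x) (F P y) ≤ μ P * (lipConst (n P) * dist x y) := by
            have := (hμ0 P).le
            gcongr
            exact (hF P).selfMap.lip x hx y hy
        _ = μ P * lipConst (n P) * dist x y := by ring
        _ ≤ K * dist x y := by gcongr; exact hK1 P)
    (fun P x hx y hy => by
      refine ((hF P).selfMap.lip_inv _ hx _ hy).trans ?_
      rw [dist_add_left, dist_smul₀, Real.norm_of_nonneg (inv_nonneg.2 (hμ0 P).le), ← mul_assoc]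
      gcongr
      exact hK2 P)
    (fun P => by simp [f])
  refine ⟨Φ, ⟨K, l1, l2⟩, fun t ht => ?_⟩
  have hev : ∀ᶠ P in U, t ∈ leaves (n P) (r P) (u P) (v P) (w P) := by
    filter_upwards [hU (eventually_ge_atTop {(⟨t, ht⟩ : σ)})] with P hPt
    exact hP P ⟨t, ht⟩ (hPt (by simp))
  constructor
  · intro α β γ hα hβ hγ hs
    refine tendsto_nhds_unique_of_eventuallyEq (tΦ _)
      (((tΦ t.a).const_smul α |>.add ((tΦ t.b).const_smul β)).add ((tΦ t.c).const_smul γ)) ?_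
    filter_upwards [hev] with P h
    exact ((hF P).leaf t h).1.smul_sub (μ P) (F P 0) α β γ hα hβ hγ hs
  · have hlim := (continuous_ar.tendsto (Φ t.a, Φ t.b, Φ t.c)).comp
      ((tΦ t.a).prodMk_nhds ((tΦ t.b).prodMk_nhds (tΦ t.c)))
    refine tendsto_nhds_unique_of_eventuallyEq (hlim.mul_const (|t.sarea| * V))
      (tendsto_const_nhds (x := t.sarea)) ?_
    filter_upwards [hev] with P h
    simp only [Function.comp_apply, f]
    rw [ar_smul_sub]
    have h1 := ((hF P).leaf t h).2
    have h2 := hμsq P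
    obtain ⟨j, hj⟩ := Nat.exists_eq_add_of_le' (hn P)
    have hfib : (0 : ℝ) < Nat.fib (n P) := by rw [hj]; exact fib_pos' j
    have h3 : ar (F P t.a) (F P t.b) (F P t.c) * |t.sarea| = t.sarea * c P := by
      simp only [c]
      rw [← mul_div_assoc, eq_div_iff hfib.ne']
      exact h1
    linear_combination μ P ^ 2 * V * h3 + t.sarea * h2

/-! ### Areas of triangles and derivatives of affine pieces -/

/-- The linear map that takes the standard basis to `p`, `q`. -/
def colMap (p q : Plane) : Plane →ₗ[ℝ] Plane where
  toFun x := x 0 • p + x 1 • q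
  map_add' x y := by simp only [PiLp.add_apply]; module
  map_smul' c x := by simp only [PiLp.smul_apply, smul_eq_mul, RingHom.id_apply]; module

theorem colMap_apply (p q x : Plane) : colMap p q x = x 0 • p + x 1 • q := rfl

theorem det_colMap (p q : Plane) : LinearMap.det (colMap p q) = cross p q := by
  rw [← LinearMap.det_toMatrix (EuclideanSpace.basisFun (Fin 2) ℝ).toBasis, Matrix.det_fin_two]
  simp [LinearMap.toMatrix_apply, colMap_apply, cross]
  ring

/-- The area of the standard triangle. -/
def stdArea : ℝ := (volume (tri 0 !₂[1, 0] !₂[0, 1])).toReal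

theorem ar_std : ar 0 !₂[1, 0] !₂[0, 1] = 1 := by simp [ar_eq]

theorem volume_tri_ne_top (u v w : Plane) : volume (tri u v w) ≠ ⊤ :=
  (isCompact_tri u v w).measure_lt_top.ne

theorem stdArea_pos : 0 < stdArea := by
  have h := interior_tri_nonempty (u := 0) (v := !₂[1, 0]) (w := !₂[0, 1]) (by simp [ar_std])
  exact ENNReal.toReal_pos (isOpen_interior.measure_pos volume h |>.trans_le
    (measure_mono interior_subset)).ne' (volume_tri_ne_top _ _ _)

/-- The triangle is an affine image of the standard one. The value of `stdArea` is never needed,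
only its positivity, as the prescribed area absorbs it. -/
theorem volume_tri (a b c : Plane) : (volume (tri a b c)).toReal = |ar a b c| * stdArea := by
  have e : tri a b c = (fun x => a + x) '' (colMap (b - a) (c - a) '' tri 0 !₂[1, 0] !₂[0, 1]) := by
    ext x
    simp only [Set.mem_image, exists_exists_and_eq_and]
    constructor
    · intro hx
      obtain ⟨α, β, γ, hα, hβ, hγ, hs, rfl⟩ := mem_tri.1 hx
      refine ⟨_, mem_tri.2 ⟨α, β, γ, hα, hβ, hγ, hs, rfl⟩, ?_⟩
      obtain rfl : α = 1 - β - γ := by linarith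
      simp only [colMap_apply]
      simp
      module
    · rintro ⟨y, hy, rfl⟩
      obtain ⟨α, β, γ, hα, hβ, hγ, hs, rfl⟩ := mem_tri.1 hy
      refine mem_tri.2 ⟨α, β, γ, hα, hβ, hγ, hs, ?_⟩
      obtain rfl : α = 1 - β - γ := by linarith
      simp only [colMap_apply]
      simp
      module
  rw [e, Set.image_add_left, measure_preimage_add, Measure.addHaar_image_linearMap, det_colMap,
    ENNReal.toReal_mul, ENNReal.toReal_ofReal (abs_nonneg _)]
  rfl

theorem volume_region (t : HalfTile) : (volume t.region).toReal = |t.sarea| * stdArea :=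
  volume_tri t.a t.b t.c

/-- The derivative of a map that is affine on a triangle. -/
theorem AffineOn.hasFDerivAt {F : Plane → Plane} {a b c : Plane} (h : AffineOn F a b c)
    (hne : ar a b c ≠ 0) {x : Plane} (hx : x ∈ interior (tri a b c)) :
    DifferentiableAt ℝ F x ∧ (fderiv ℝ F x).det * ar a b c = ar (F a) (F b) (F c) := by
  -- By Cramer's rule `C` is the inverse of `colMap (b - a) (c - a)`.
  let C := colMap !₂[(c - a) 1 / ar a b c, -(b - a) 1 / ar a b c]
    !₂[-(c - a) 0 / ar a b c, (b - a) 0 / ar a b c]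
  let N : Plane →L[ℝ] Plane := (colMap (F b - F a) (F c - F a) ∘ₗ C).toContinuousLinearMap
  have hN : ∀ y ∈ tri a b c, F y = F a + N (y - a) := by
    intro y hy
    obtain ⟨α, β, γ, hα, hβ, hγ, hs, rfl⟩ := mem_tri.1 hy
    rw [h α β γ hα hβ hγ hs]
    obtain rfl : α = 1 - β - γ := by linarith
    have e0 : C ((1 - β - γ) • a + β • b + γ • c - a) 0 = β := by
      simp only [C, colMap_apply, PiLp.add_apply, PiLp.smul_apply, PiLp.sub_apply, smul_eq_mul]
      simp
      field_simp
      simp only [ar_eq]; ring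
    have e1 : C ((1 - β - γ) • a + β • b + γ • c - a) 1 = γ := by
      simp only [C, colMap_apply, PiLp.add_apply, PiLp.smul_apply, PiLp.sub_apply, smul_eq_mul]
      simp
      field_simp
      simp only [ar_eq]; ring
    have : N ((1 - β - γ) • a + β • b + γ • c - a) = β • (F b - F a) + γ • (F c - F a) := by
      show colMap (F b - F a) (F c - F a) (C ((1 - β - γ) • a + β • b + γ • c - a)) = _
      rw [colMap_apply, e0, e1]
    rw [this]
    module
  have hd : HasFDerivAt F N x := by
    have h1 : HasFDerivAt (fun y => F a + N (y - a)) N x := by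
      have := (N.hasFDerivAt (x := x - a)).comp x ((hasFDerivAt_id x).sub_const a)
      simpa using this.const_add (F a)
    refine h1.congr_of_eventuallyEq ?_
    filter_upwards [mem_interior_iff_mem_nhds.1 hx] with y hy using hN y hy
  refine ⟨hd.differentiableAt, ?_⟩
  rw [hd.fderiv]
  have hdet : N.det = ar (F a) (F b) (F c) * (1 / ar a b c) := by
    show LinearMap.det (colMap (F b - F a) (F c - F a) ∘ₗ C) = _
    rw [LinearMap.det_comp, det_colMap, det_colMap]
    congr 1
    simp only [cross]
    simp
    field_simp
    simp only [ar_eq]; ring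
  rw [hdet]
  field_simp

/-! ### The function of the tiling almost everywhere -/

theorem closure_interior_region {t : HalfTile} (h : t.sarea ≠ 0) :
    t.region ⊆ closure (interior t.region) := by
  have := (convex_tri t.a t.b t.c).closure_interior_eq_closure_of_nonempty_interior
    (interior_tri_nonempty h)
  exact subset_closure.trans this.superset

/-- A half tile that meets the interior of another one is equal to it. -/
theorem IsHalfTileTiling.eq_of_mem {σ : Set HalfTile} (hσ : IsHalfTileTiling σ) {t t' : HalfTile}
    (ht : t ∈ σ) (ht' : t' ∈ σ) {x : Plane} (hx : x ∈ interior t.region) (hx' : x ∈ t'.region) :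
    t = t' := by
  by_contra hne
  have hc := closure_interior_region (hσ.wellShaped ht').2 hx'
  obtain ⟨y, hy, hy'⟩ := mem_closure_iff.1 hc _ isOpen_interior hx
  exact Set.disjoint_left.1 (hσ.disjoint ht ht' hne) hy hy'

theorem IsHalfTileTiling.countable {σ : Set HalfTile} (hσ : IsHalfTileTiling σ) : σ.Countable := by
  have : σ.PairwiseDisjoint fun t => interior t.region := hσ.disjoint
  exact this.countable_of_isOpen (fun t _ => isOpen_interior)
    fun t ht => interior_tri_nonempty (hσ.wellShaped ht).2

theorem volume_frontier_region (t : HalfTile) : volume (frontier t.region) = 0 :=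
  (convex_tri t.a t.b t.c).addHaar_frontier volume

/-- The frontiers of convex sets are null, and there are only countably many half tiles. -/
theorem IsHalfTileTiling.ae_mem_interior {σ : Set HalfTile} (hσ : IsHalfTileTiling σ) :
    ∀ᵐ x : Plane, ∃ t ∈ σ, x ∈ interior t.region := by
  have : ∀ᵐ x : Plane, ∀ t ∈ σ, x ∉ frontier t.region := by
    rw [ae_ball_iff hσ.countable]
    intro t _
    exact measure_eq_zero_iff_ae_notMem.1 (volume_frontier_region t)
  filter_upwards [this] with x hx
  obtain ⟨t, ht, hxt⟩ := hσ.exists_mem x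
  refine ⟨t, ht, ?_⟩
  by_contra hni
  exact hx t ht ⟨subset_closure hxt, hni⟩

/-- The tile around `x` need not be shown to be unique; it is enough that all candidates have the
same area. -/
theorem tilingFun_eq {τ : Set (Set Plane)} {x : Plane} {c : ℝ} (h : ∃ T ∈ τ, x ∈ interior T)
    (hc : ∀ T ∈ τ, x ∈ interior T → (volume T).toReal = c) : tilingFun τ x = 1 / c := by
  rw [tilingFun, dif_pos h, hc _ h.choose_spec.1 h.choose_spec.2]

theorem tilingFun_triangles {σ : Set HalfTile} (hσ : IsHalfTileTiling σ) {t : HalfTile}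
    (ht : t ∈ σ) {x : Plane} (hx : x ∈ interior t.region) :
    tilingFun (triangles σ) x = 1 / (|t.sarea| * stdArea) := by
  refine tilingFun_eq ⟨_, ⟨t, ht, rfl⟩, hx⟩ ?_
  rintro _ ⟨t', ht', rfl⟩ hx'
  rw [← hσ.eq_of_mem ht ht' hx (interior_subset hx'), volume_region]

/-- The sides of a half tile are determined by its kind and its axis. -/
theorem dist_eq_of_axis {t t' : HalfTile} (h : t.IsWellShaped) (h' : t'.IsWellShaped)
    (hk : t.kind = t'.kind) (hb : t.b = t'.b) (hc : t.c = t'.c) :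
    dist t.a t.b = dist t'.a t'.b ∧ dist t.a t.c = dist t'.a t'.c := by
  obtain ⟨k, a, b, c⟩ := t
  obtain ⟨k', a', b', c'⟩ := t'
  simp only at hk hb hc
  subst hk hb hc
  have hφ := Real.goldenRatio_ne_zero
  cases k <;> simp only [HalfTile.IsWellShaped] at h h' ⊢ <;> obtain ⟨-, h1, h2⟩ := h <;>
    obtain ⟨-, h1', h2'⟩ := h'
  · have := mul_left_cancel₀ hφ (h2.symm.trans h2')
    rw [dist_comm a b, dist_comm a' b, h1, h1', this]
    exact ⟨rfl, rfl⟩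
  · rw [h2, h2', dist_comm a b, dist_comm a' b, ← h1, ← h1']
    exact ⟨rfl, rfl⟩
  · rw [h1, h1', h2, h2']
    exact ⟨rfl, rfl⟩
  · have := mul_left_cancel₀ hφ (h2.symm.trans h2')
    rw [h1, h1', this]
    exact ⟨rfl, rfl⟩

theorem abs_sarea_eq_of_axis {t t' : HalfTile} (h : t.IsWellShaped) (h' : t'.IsWellShaped)
    (hk : t.kind = t'.kind) (hb : t.b = t'.b) (hc : t.c = t'.c) : |t.sarea| = |t'.sarea| := by
  obtain ⟨e1, e2⟩ := dist_eq_of_axis h h' hk hb hc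
  have h1 := ar_sq t.a t.b t.c
  have h2 := ar_sq t'.a t'.b t'.c
  rw [e1, e2, hb, hc, ← h2] at h1
  rw [← sq_eq_sq_iff_abs_eq_abs]
  unfold HalfTile.sarea
  rw [hb, hc]
  linarith

/-- There are only two half tiles of the same kind with the same axis. -/
theorem eq_of_axis {t t₁ t₂ : HalfTile} (h : t.IsWellShaped) (h₁ : t₁.IsWellShaped)
    (h₂ : t₂.IsWellShaped) (hne : t.sarea ≠ 0) (n₁ : t ≠ t₁) (n₂ : t ≠ t₂)
    (e₁ : t₁.kind = t.kind ∧ t₁.b = t.b ∧ t₁.c = t.c)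
    (e₂ : t₂.kind = t.kind ∧ t₂.b = t.b ∧ t₂.c = t.c) : t₁ = t₂ := by
  have hbc : t.b ≠ t.c := by
    intro e
    apply hne
    rw [HalfTile.sarea, e, ar_self_right]
  have d₁ := dist_eq_of_axis h₁ h e₁.1 e₁.2.1 e₁.2.2
  have d₂ := dist_eq_of_axis h₂ h e₂.1 e₂.2.1 e₂.2.2
  rw [e₁.2.1, e₁.2.2] at d₁
  rw [e₂.2.1, e₂.2.2] at d₂
  have hn : ∀ {s : HalfTile}, t ≠ s → s.kind = t.kind ∧ s.b = t.b ∧ s.c = t.c → t.a ≠ s.a :=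
    fun hn e ha => hn (HalfTile.ext e.1.symm ha e.2.1.symm e.2.2.symm)
  have : t₂.a = t.a ∨ t₂.a = t₁.a := by
    by_contra hcon
    push Not at hcon
    -- Circles about the distinct points `t.b` and `t.c` meet in at most two points, and `t.a`,
    -- `t₁.a` are already two.
    have := EuclideanGeometry.eq_of_dist_eq_of_dist_eq_of_finrank_eq_two
      (by simp) hbc (hn n₁ e₁) (p := t₂.a) rfl d₁.1 d₂.1 rfl d₁.2 d₂.2
    tauto
  rcases this with ha | ha
  · exact absurd ha.symm (hn n₂ e₂)
  · exact HalfTile.ext (e₁.1.trans e₂.1.symm) ha.symm (e₁.2.1.trans e₂.2.1.symm)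
      (e₁.2.2.trans e₂.2.2.symm)

/-- Each half tile of the tiling is completed to a whole tile. -/
theorem IsHalfTileTiling.exists_partner {σ : Set HalfTile} (hσ : IsHalfTileTiling σ)
    {t : HalfTile} (ht : t ∈ σ) :
    ∃ t' ∈ σ, t ≠ t' ∧ t'.kind = t.kind ∧ t'.b = t.b ∧ t'.c = t.c := by
  classical
  -- `Q` forces `t.b` into the interior of the triangle, so that the axis of `t` is not on its
  -- boundary.
  obtain ⟨Q, hQ⟩ := hσ.exists_spanning (R := ‖t.b‖ + 1) (by positivity)
  have local_partner : ∀ P : Finset σ, ⟨t, ht⟩ ∈ P → ∃ (n : ℕ) (r : Bool) (u v w : Plane),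
      Shape r u v w ∧ (∀ s ∈ P, (s : HalfTile) ∈ leaves n r u v w) ∧
      ∃ t' ∈ leaves n r u v w, t ≠ t' ∧ t'.kind = t.kind ∧ t'.b = t.b ∧ t'.c = t.c := by
    intro P hP
    obtain ⟨n, r, u, v, w, _, hS, h⟩ := hσ.exists_patch (P ∪ Q)
    refine ⟨n, r, u, v, w, hS, fun s hs => h s (Finset.mem_union_left _ hs), ?_⟩
    refine Penrose.exists_partner hS (h ⟨t, ht⟩ (Finset.mem_union_left _ hP)) ?_
    refine interior_maximal (hQ n r u v w fun s hs => h s (Finset.mem_union_right _ hs))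
      Metric.isOpen_ball ?_
    simp
  obtain ⟨n, r, u, v, w, hS, -, t₁, ht₁, hne₁, e₁⟩ := local_partner {⟨t, ht⟩} (by simp)
  have hopen : IsOpen (interior t₁.region) := isOpen_interior
  have hpos := hopen.measure_pos volume (interior_tri_nonempty (leaves_sarea_ne_zero hS ht₁))
  -- The half tile `t₁` belongs to the dissection of a triangle, but not yet to `σ`. Some `s` in `σ`
  -- overlaps it, and a second patch, containing both `t` and `s`, will show that `s` is the
  -- partner: the partner `t₂` there equals `t₁`, and overlapping half tiles of one dissection
  -- coincide.
  obtain ⟨y, hy, s, hs, hys⟩ : ∃ y ∈ interior t₁.region, ∃ s ∈ σ, y ∈ interior s.region := by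
    by_contra hcon
    push Not at hcon
    refine hpos.ne' (measure_mono_null (fun y hy => ?_) (ae_iff.1 hσ.ae_mem_interior))
    rintro ⟨s, hs, hys⟩
    exact hcon y hy s hs hys
  obtain ⟨n', r', u', v', w', hS', hP', t₂, ht₂, hne₂, e₂⟩ :=
    local_partner {⟨t, ht⟩, ⟨s, hs⟩} (by simp)
  have ht' := hσ.wellShaped ht
  have h12 : t₁ = t₂ := eq_of_axis ht'.1 (leaves_wellShaped hS ht₁) (leaves_wellShaped hS' ht₂)
    ht'.2 hne₁ hne₂ e₁ e₂
  have hst : s = t₂ := by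
    by_contra hne
    have := leaves_disjoint hS' (hP' ⟨s, hs⟩ (by simp)) t₂ ht₂ hne
    exact Set.disjoint_left.1 this hys (h12 ▸ hy)
  subst hst
  exact ⟨s, hs, hne₂, e₂⟩

theorem volume_union_region {σ : Set HalfTile} (hσ : IsHalfTileTiling σ) {t t' : HalfTile}
    (ht : t ∈ σ) (ht' : t' ∈ σ) (hne : t ≠ t') :
    (volume (t.region ∪ t'.region)).toReal = (|t.sarea| + |t'.sarea|) * stdArea := by
  have hd : AEDisjoint volume t.region t'.region := by
    refine measure_mono_null (t := frontier t.region) ?_ (volume_frontier_region t)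
    rintro x ⟨hx, hx'⟩
    exact ⟨subset_closure hx, fun hi => hne (hσ.eq_of_mem ht ht' hi hx')⟩
  have hm : MeasurableSet t'.region := (isCompact_tri _ _ _).measurableSet
  have hfin : ∀ s : HalfTile, volume s.region ≠ ⊤ := fun s => volume_tri_ne_top _ _ _
  rw [measure_union₀ hm.nullMeasurableSet hd, ENNReal.toReal_add (hfin t) (hfin t'),
    volume_region, volume_region]
  ring

/-- Any whole tile with `x` in its interior has `t` as one of its halves, and both halves have equal
area because their sides have equal lengths. -/
theorem tilingFun_wholeTiles {σ : Set HalfTile} (hσ : IsHalfTileTiling σ) {t : HalfTile}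
    (ht : t ∈ σ) {x : Plane} (hx : x ∈ interior t.region) :
    tilingFun (wholeTiles σ) x = 1 / (2 * |t.sarea| * stdArea) := by
  obtain ⟨t', ht', hne, hk, hb, hc⟩ := hσ.exists_partner ht
  refine tilingFun_eq ⟨t.region ∪ t'.region,
    ⟨t, ht, t', ht', hne, hk.symm, hb.symm, hc.symm, rfl⟩,
    interior_mono Set.subset_union_left hx⟩ ?_
  rintro _ ⟨p, hp, q, hq, hpq, hk, hb, hc, rfl⟩ hx'
  rw [volume_union_region hσ hp hq hpq]
  have hpq' := abs_sarea_eq_of_axis (hσ.wellShaped hp).1 (hσ.wellShaped hq).1 hk hb hc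
  rcases interior_subset hx' with h | h
  · rw [← hpq', ← hσ.eq_of_mem ht hp hx h]; ring
  · rw [hpq', ← hσ.eq_of_mem ht hq hx h]; ring

end Penrose

end

/-! ### The corollary -/

theorem corollary1p5 (τ : Set (Set Penrose.Plane)) (hτ : Penrose.IsPenroseTiling τ) :
    ∃ φ : Penrose.Plane ≃ₜ Penrose.Plane,
      (∃ K : NNReal, LipschitzWith K φ ∧ LipschitzWith K φ.symm) ∧
      ∀ᵐ x ∂(MeasureTheory.volume : MeasureTheory.Measure Penrose.Plane),
        DifferentiableAt ℝ φ x ∧ (fderiv ℝ φ x).det = Penrose.tilingFun τ x := by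
  obtain ⟨σ, hσ, hτ⟩ := hτ
  -- `V` is the quotient of the area of a tile by `|t.sarea|` for a half tile `t` in it; only here
  -- do the two kinds of tilings differ, by a factor 2.
  obtain ⟨V, hV, hval⟩ : ∃ V : ℝ, 0 < V ∧ ∀ t ∈ σ, ∀ x ∈ interior t.region,
      Penrose.tilingFun τ x = 1 / (|t.sarea| * V) := by
    have hpos := Penrose.stdArea_pos
    rcases hτ with rfl | rfl
    · exact ⟨2 * Penrose.stdArea, by positivity, fun t ht x hx => by
        rw [Penrose.tilingFun_wholeTiles hσ ht hx]; ring⟩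
    · exact ⟨Penrose.stdArea, hpos, fun t ht x hx => Penrose.tilingFun_triangles hσ ht hx⟩
  obtain ⟨Φ, hK, hΦ⟩ := hσ.exists_homeomorph hV
  refine ⟨Φ, hK, ?_⟩
  filter_upwards [hσ.ae_mem_interior] with x ⟨t, ht, hx⟩
  have hne := (hσ.wellShaped ht).2
  obtain ⟨hA, hdet⟩ := hΦ t ht
  obtain ⟨h1, h2⟩ := hA.hasFDerivAt hne hx
  refine ⟨h1, ?_⟩
  rw [hval t ht x hx, eq_div_iff (by positivity)]
  rw [← h2] at hdet
  refine mul_right_cancel₀ hne ?_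
  rw [one_mul]
  rw [mul_right_comm]
  exact hdet
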